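/- **Branching Wiener process.** Let $d\ge 1$. A particle starts at time $0$ from the origin of $\mathbb R^d$ and executes a Wiener process. At time $1$, at its new location, it dies and is replaced by $Y$ offspring, where $\mathbf P(Y=\ell)=p_\ell$ $(\ell=0,1,2,\dots)$, with $$1<m:=\sum_{\ell}\ell p_\ell<\infty,\qquad 0<\sigma^2:=\sum_\ell(\ell-m)^2p_\ell<\infty .$$ Each offspring, starting from the place where its parent dies, executes a Wiener process for one unit of time and repeats these steps, and so on. All Wiener processes and offspring numbers are independent of each other. **Hermite sums.** For $n\in\mathbb Z_+$, $x,t\in\mathbb R$ put $$H_n(x,t)=\sum_{j=0}^{\lfloor n/2\rfloor}\frac{n!}{j!\,(n-2j)!}\Big(\frac{-t}{2}\Big)^j x^{n-2j},$$ and for $\alpha\in\mathbb Z_+^d$, $x\in\mathbb R^d$ put $H_\alpha(x,t)=\prod_{i=1}^d H_{\alpha_i}(x_i,t)$. For $t=0,1,2,\dots$ let $$V_\alpha(t)=\sum_{y}H_\alpha(y,t),$$ where $y$ runs over the locations of all particles present at time $t$, one term for each particle. The particles present at time $t$ may be taken either immediately after the branching at time $t$ (generation $t$, at the places of birth) or immediately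 before it (for $t\ge 1$: generation $t-1$, at the places of death; for $t=0$: the ancestor at the origin); the proposition holds in both cases. **Proposition.** Let $p\ge 2$ be an even integer with $\mathbf E(|Y|^p)<\infty$, and let $\alpha\in\mathbb Z_+^d$. Then $V_\alpha(t)/m^t$ converges in $L^p$ as $t\to\infty$ through the integers: every $V_\alpha(t)/m^t$ belongs to $L^p$, and there is a random variable $N_\alpha\in L^p$ such that $$\mathbf E\left|\frac{V_\alpha(t)}{m^t}-N_\alpha\right|^p\longrightarrow 0 \qquad(t\to\infty).$$ Moreover $N_\alpha$ is also the almost sure limit of $V_\alpha(t)/m^t$. -/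

import Mathlib

open MeasureTheory ProbabilityTheory Filter
open scoped NNReal ENNReal Topology

namespace BranchingWiener

/-- The time-dependent Hermite polynomials of one variable,
`H_n(x,t) = ∑_{j ≤ n/2} n! / (j! (n-2j)!) (-t/2)^j x^(n-2j)`. -/
noncomputable def hermiteOne (n : ℕ) (x t : ℝ) : ℝ :=
  ∑ j ∈ Finset.range (n / 2 + 1),
    (n.factorial : ℝ) / ((j.factorial : ℝ) * ((n - 2 * j).factorial : ℝ)) *
      (-t / 2) ^ j * x ^ (n - 2 * j)

/-- `H_α(x,t) = ∏ᵢ H_{αᵢ}(xᵢ,t)` for a multi-index `α`. -/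
noncomputable def hermite {d : ℕ} (α : Fin d → ℕ) (x : Fin d → ℝ) (t : ℝ) : ℝ :=
  ∏ i, hermiteOne (α i) (x i) t

/-- Potential particles are labelled by finite words over `ℕ` (Ulam-Harris labels, last letter
first): `[]` is the ancestor and `i :: u` is the `i`-th child of `u`. The particle `u` lives
during the time interval `[u.length, u.length + 1]`.

`W u i s` is the `i`-th coordinate of the displacement of the particle `u` at age `s`, measured
from its birth place (only ages `s ≤ 1` matter), and `Y u` is its number of offspring.
The displacements are `d`-dimensional Wiener processes, the offspring numbers have law `ν`, and
all of them are independent. -/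
structure IsBranchingWienerProcess {Ω : Type*} [MeasurableSpace Ω] {d : ℕ}
    (W : List ℕ → Fin d → ℝ≥0 → Ω → ℝ) (Y : List ℕ → Ω → ℕ) (ν : Measure ℕ)
    (P : Measure Ω) : Prop where
  measurable_displacement : ∀ u i s, Measurable (W u i s)
  measurable_offspring : ∀ u, Measurable (Y u)
  /-- each coordinate of each displacement is a standard real Brownian motion -/
  wiener : ∀ u i, IsBrownianReal (W u i) P
  /-- each offspring number has law `ν` -/
  offspring_law : ∀ u, HasLaw (Y u) ν P
  /-- the paths of all coordinates of all particles are independent -/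
  indep_displacement :
    iIndepFun (fun (q : List ℕ × Fin d) (ω : Ω) (s : ℝ≥0) => W q.1 q.2 s ω) P
  /-- all offspring numbers are independent -/
  indep_offspring : iIndepFun Y P
  /-- the family of all paths is independent of the family of all offspring numbers -/
  indep_displacement_offspring :
    IndepFun (fun (ω : Ω) (q : List ℕ × Fin d) (s : ℝ≥0) => W q.1 q.2 s ω)
      (fun (ω : Ω) (u : List ℕ) => Y u ω) P

variable {Ω : Type*} {d : ℕ}

/-- The particles of generation `n` that are actually born. They live during `[n, n + 1]`. -/
def generation (Y : List ℕ → Ω → ℕ) : ℕ → Ω → Finset (List ℕ)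
  | 0, _ => {[]}
  | n + 1, ω => (generation Y n ω).biUnion fun u =>
      (Finset.range (Y u ω)).image fun i => i :: u

/-- The place where a particle is born: the ancestor starts from the origin, every other particle
starts from the place where its parent dies (at age `1`). -/
def birthPlace (W : List ℕ → Fin d → ℝ≥0 → Ω → ℝ) : List ℕ → Ω → Fin d → ℝ
  | [], _ => 0
  | _ :: u, ω => fun i => birthPlace W u ω i + W u i 1 ω

/-- The place of the particle `u` at age `s`, that is, at time `u.length + s`. -/
def place (W : List ℕ → Fin d → ℝ≥0 → Ω → ℝ) (u : List ℕ) (s : ℝ≥0) (ω : Ω) : Fin d → ℝ :=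
  fun i => birthPlace W u ω i + W u i s ω

/-- `V_α(t)`, the sum of `H_α(·,t)` over the places of the particles present at time `t`
immediately after the branching at time `t`. These are the members of generation `t`, each of them
at its birth place. -/
noncomputable def hermiteSumAfter (W : List ℕ → Fin d → ℝ≥0 → Ω → ℝ) (Y : List ℕ → Ω → ℕ)
    (α : Fin d → ℕ) (t : ℕ) (ω : Ω) : ℝ :=
  ∑ u ∈ generation Y t ω, hermite α (birthPlace W u ω) t

/-- `V_α(t)`, the sum of `H_α(·,t)` over the places of the particles present at time `t`
immediately before the branching at time `t`. At time `0` this is the ancestor at the origin; at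
time `n + 1` these are the members of generation `n` at age `1`. -/
noncomputable def hermiteSumBefore (W : List ℕ → Fin d → ℝ≥0 → Ω → ℝ) (Y : List ℕ → Ω → ℕ)
    (α : Fin d → ℕ) : ℕ → Ω → ℝ
  | 0, _ => hermite α 0 0
  | n + 1, ω => ∑ u ∈ generation Y n ω, hermite α (place W u 1 ω) ((n + 1 : ℕ) : ℝ)

/-- The mean `m = ∑ ℓ, ℓ p_ℓ` of the offspring law. -/
noncomputable def offspringMean (ν : Measure ℕ) : ℝ := ∫ ℓ, (ℓ : ℝ) ∂ν

/-- The random variables `X t` belong to `L^p` and converge, as `t → ∞`, almost surely and in `L^p`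
to one random variable `N` of `L^p`. -/
def ConvergesInLpAndAE [MeasurableSpace Ω] (X : ℕ → Ω → ℝ) (p : ℝ≥0∞) (P : Measure Ω) : Prop :=
  (∀ t, MemLp (X t) p P) ∧
  ∃ N : Ω → ℝ, MemLp N p P ∧
    Tendsto (fun t => eLpNorm (X t - N) p P) atTop (𝓝 0) ∧
    ∀ᵐ ω ∂P, Tendsto (fun t => X t ω) atTop (𝓝 (N ω))

end BranchingWiener

/-! The Hermite functions are space-time harmonic for Brownian motion, so `D t = V (t + 1) - m * V
t` is a sum of centred contributions of the particles of generation `t`. It is enough that the `L^p`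
norm of `D t` is at most `C * r ^ t` with `r < m`: then the increments of `V t / m ^ t` have
geometrically summable norms, which gives convergence in `L^p` and almost surely together.

The bound comes from decomposing the tree at the ancestor instead of conditioning on generation `t`.
By the addition formula `hermite_add`, the displacement `x` of the ancestor splits off, and `D (t +
1)` for `α` becomes the sum over `β ≤ α` of binomial coefficients times `H_(α-β)(x, 1)` times a sum
over the children of copies of `D t` for `β`, taken in their subtrees. These copies are centred,
independent, and independent of the ancestor. For even `p` a moment inequality
(`integral_sum_pow_le`, `eLpNorm_mul_randomSum_le`) bounds the `p`-norm of such a random sum by `m ^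
(1/p)` times the `p`-norm of one copy plus a constant times its `(p-2)`-norm.

Hence a double induction, on `p` in steps of two and on `α` (`geomBounded_increment`). The term `β =
α` has coefficient `1`, so the only term not yet controlled recurs with factor `m ^ (1/p)`, which is
less than `m` because `m > 1` and `p ≥ 2`.

The sums before branching differ from those after the preceding branching by a quantity of the same
kind, with offspring weight `1` in place of the number of children. For this reason `increment`
carries a general weight `φ` with mean `c`. -/

namespace BranchingWiener

/-! ### Hermite polynomials: generating series and addition formula. -/

/-- The generating series `exp (x z)`. -/
noncomputable def expSeries (x : ℝ) : PowerSeries ℝ :=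
  PowerSeries.rescale x (PowerSeries.exp ℝ)

/-- The generating series `exp (-t z² / 2)`. -/
noncomputable def gaussSeries (t : ℝ) : PowerSeries ℝ :=
  PowerSeries.expand 2 two_ne_zero (expSeries (-t / 2))

theorem expSeries_add (x y : ℝ) : expSeries (x + y) = expSeries x * expSeries y :=
  (PowerSeries.exp_mul_exp_eq_exp_add x y).symm

theorem gaussSeries_add (s t : ℝ) : gaussSeries (s + t) = gaussSeries s * gaussSeries t := by
  unfold gaussSeries
  rw [← map_mul, ← expSeries_add]
  congr 2
  ring

theorem coeff_expSeries (x : ℝ) (n : ℕ) :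
    PowerSeries.coeff n (expSeries x) = x ^ n / n.factorial := by
  simp [expSeries, PowerSeries.coeff_rescale, PowerSeries.coeff_exp, div_eq_mul_inv]

theorem coeff_gaussSeries_two_mul (t : ℝ) (j : ℕ) :
    PowerSeries.coeff (2 * j) (gaussSeries t) = (-t / 2) ^ j / j.factorial := by
  rw [gaussSeries, PowerSeries.coeff_expand_mul, coeff_expSeries]

theorem coeff_gaussSeries_of_not_dvd (t : ℝ) {n : ℕ} (h : ¬ 2 ∣ n) :
    PowerSeries.coeff n (gaussSeries t) = 0 := by
  rw [gaussSeries, PowerSeries.coeff_expand_of_not_dvd _ _ _ h]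

theorem gaussSeries_zero : gaussSeries 0 = 1 := by
  have : expSeries 0 = 1 := by
    ext n
    rw [coeff_expSeries, PowerSeries.coeff_one]
    rcases n with _ | n <;> simp
  simp [gaussSeries, this]

/-- The generating function is `exp (x z - t z² / 2)`. Only even degrees of the Gaussian factor
contribute, so `j` corresponds to degree `2 * j` in the Cauchy product. -/
theorem hermiteOne_eq_coeff (n : ℕ) (x t : ℝ) :
    hermiteOne n x t = n.factorial * PowerSeries.coeff n (gaussSeries t * expSeries x) := by
  rw [PowerSeries.coeff_mul, Finset.Nat.sum_antidiagonal_eq_sum_range_succ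
    (fun i j => PowerSeries.coeff i (gaussSeries t) * PowerSeries.coeff j (expSeries x)) n,
    hermiteOne, Finset.mul_sum]
  refine Finset.sum_bij_ne_zero (fun j _ _ => 2 * j) ?_ ?_ ?_ ?_
  · intro j hj _
    simp only [Finset.mem_range] at *
    omega
  · intro a _ _ b _ _ h
    omega
  · intro i hi h
    have h2 : 2 ∣ i := by
      by_contra hc
      exact h (by rw [coeff_gaussSeries_of_not_dvd t hc]; simp)
    obtain ⟨j, rfl⟩ := h2
    rw [coeff_gaussSeries_two_mul, coeff_expSeries] at h
    refine ⟨j, ?_, fun h0 => h ?_, rfl⟩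
    · simp only [Finset.mem_range] at *
      omega
    · rw [← h0]
      field_simp
  · intro j _ _
    rw [coeff_gaussSeries_two_mul, coeff_expSeries]
    field_simp

/-- Both exponential factors turn sums of parameters into products of series; comparing coefficients
gives a binomial formula. -/
theorem hermiteOne_add (n : ℕ) (x y s t : ℝ) :
    hermiteOne n (x + y) (s + t) = ∑ k ∈ Finset.range (n + 1),
      (n.choose k : ℝ) * hermiteOne (n - k) x s * hermiteOne k y t := by
  rw [hermiteOne_eq_coeff, expSeries_add, gaussSeries_add,
    show gaussSeries s * gaussSeries t * (expSeries x * expSeries y) =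
      (gaussSeries t * expSeries y) * (gaussSeries s * expSeries x) by ring, PowerSeries.coeff_mul,
    Finset.Nat.sum_antidiagonal_eq_sum_range_succ
    (fun i j => PowerSeries.coeff i (gaussSeries t * expSeries y) *
      PowerSeries.coeff j (gaussSeries s * expSeries x)) n, Finset.mul_sum]
  refine Finset.sum_congr rfl fun k hk => ?_
  have hk : k ≤ n := by simpa [Nat.lt_succ_iff] using hk
  rw [hermiteOne_eq_coeff, hermiteOne_eq_coeff, Nat.cast_choose ℝ hk]
  field_simp

theorem hermiteOne_zero_left (x t : ℝ) : hermiteOne 0 x t = 1 := by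
  simp [hermiteOne]

/-- The product of the binomial coefficients `α i` over `β i`. -/
def multiChoose {d : ℕ} (α β : Fin d → ℕ) : ℕ := ∏ i, (α i).choose (β i)

theorem hermite_add {d : ℕ} (α : Fin d → ℕ) (x y : Fin d → ℝ) (s t : ℝ) :
    hermite α (x + y) (s + t) = ∑ β ∈ Finset.Iic α,
      (multiChoose α β : ℝ) * hermite (α - β) x s * hermite β y t := by
  have hI : Finset.Iic α = Fintype.piFinset fun i => Finset.range (α i + 1) := by
    ext β
    simp [Pi.le_def]
  rw [hI, hermite]
  simp_rw [Pi.add_apply, hermiteOne_add]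
  rw [Finset.prod_univ_sum]
  refine Finset.sum_congr rfl fun β _ => ?_
  simp [hermite, multiChoose, Finset.prod_mul_distrib]

theorem measurable_hermiteOne (n : ℕ) (t : ℝ) : Measurable fun x => hermiteOne n x t := by
  unfold hermiteOne
  fun_prop

theorem measurable_hermite {d : ℕ} (α : Fin d → ℕ) (t : ℝ) :
    Measurable fun x : Fin d → ℝ => hermite α x t :=
  Finset.measurable_prod _ fun i _ => (measurable_hermiteOne _ _).comp (measurable_pi_apply i)

/-! ### Gaussian moments and the mean of a Hermite polynomial. -/

theorem integrable_pow_gaussianReal (n : ℕ) :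
    Integrable (fun x : ℝ => x ^ n) (gaussianReal 0 1) := by
  rcases Nat.eq_zero_or_pos n with rfl | hn
  · simp
  · have h := (memLp_id_gaussianReal' (μ := 0) (v := 1) n (by simp)).integrable_norm_rpow
      (by simpa using hn.ne') (by simp)
    refine Integrable.mono' h (by fun_prop) (ae_of_all _ fun x => ?_)
    simp

/-- Integration by parts: the derivative of the standard Gaussian density at `x` is `-x` times the
density. -/
theorem integral_pow_add_two_gaussianReal (n : ℕ) :
    ∫ x : ℝ, x ^ (n + 2) ∂(gaussianReal 0 1) = (n + 1) * ∫ x : ℝ, x ^ n ∂(gaussianReal 0 1) := by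
  have hi : ∀ k : ℕ, Integrable fun x : ℝ => x ^ k * gaussianPDFReal 0 1 x := by
    intro k
    have h := integrable_pow_gaussianReal k
    rw [gaussianReal_of_var_ne_zero _ one_ne_zero,
      integrable_withDensity_iff_integrable_smul' (by fun_prop) (by simp [gaussianPDF])] at h
    refine h.congr (ae_of_all _ fun x => ?_)
    simp [mul_comm]
  have hd : ∀ x : ℝ, HasDerivAt (gaussianPDFReal 0 1) (-(x * gaussianPDFReal 0 1 x)) x := by
    intro x
    have h1 : HasDerivAt (fun y : ℝ => -y ^ 2 / 2) (-x) x := by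
      have := ((hasDerivAt_pow 2 x).neg).div_const 2
      refine this.congr_deriv ?_
      push_cast
      ring
    have h2 := (h1.exp).const_mul (√(2 * Real.pi))⁻¹
    have h3 : gaussianPDFReal 0 1 = fun y : ℝ => (√(2 * Real.pi))⁻¹ * Real.exp (-y ^ 2 / 2) := by
      ext y
      simp [gaussianPDFReal_def]
    rw [h3]
    refine h2.congr_deriv ?_
    ring
  have hp : ∀ x : ℝ, HasDerivAt (fun y : ℝ => y ^ (n + 1)) ((n + 1) * x ^ n) x := by
    intro x
    simpa using hasDerivAt_pow (n + 1) x
  have key := integral_mul_deriv_eq_deriv_mul_of_integrable (u := fun y : ℝ => y ^ (n + 1))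
    (v := gaussianPDFReal 0 1) (u' := fun x => (n + 1) * x ^ n)
    (v' := fun x => -(x * gaussianPDFReal 0 1 x)) (fun x _ => hp x) (fun x _ => hd x)
    (by
      refine (hi (n + 2)).neg.congr (ae_of_all _ fun x => ?_)
      simp [pow_succ]
      ring)
    (by
      refine ((hi n).const_mul ((n : ℝ) + 1)).congr (ae_of_all _ fun x => ?_)
      simp [mul_assoc])
    (hi (n + 1))
  rw [integral_gaussianReal_eq_integral_smul one_ne_zero,
    integral_gaussianReal_eq_integral_smul one_ne_zero]
  have e1 : ∫ x : ℝ, gaussianPDFReal 0 1 x • x ^ (n + 2) =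
      -∫ x : ℝ, x ^ (n + 1) * -(x * gaussianPDFReal 0 1 x) := by
    rw [← integral_neg]
    congr 1
    ext x
    simp [pow_succ]
    ring
  rw [e1, key, neg_neg, ← integral_const_mul]
  congr 1
  ext x
  simp
  ring

/-- The moment generating function of the standard Gaussian is `exp (z² / 2)`, obtained here
coefficient by coefficient from the two-step recursion for the moments. -/
theorem integral_pow_gaussianReal (n : ℕ) :
    (∫ x : ℝ, x ^ n ∂(gaussianReal 0 1)) / n.factorial =
      PowerSeries.coeff n (gaussSeries (-1)) := by
  induction n using Nat.twoStepInduction with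
  | zero =>
    have := coeff_gaussSeries_two_mul (-1) 0
    simp at this ⊢
    rw [this]
  | one =>
    rw [coeff_gaussSeries_of_not_dvd _ (by norm_num)]
    simp
  | more n ih _ =>
    rw [integral_pow_add_two_gaussianReal]
    have hf : ((n + 2).factorial : ℝ) = (n + 2) * ((n + 1) * n.factorial) := by
      push_cast [Nat.factorial_succ]
      ring
    have : ((n + 1) * ∫ x : ℝ, x ^ n ∂(gaussianReal 0 1)) / (n + 2).factorial =
        ((∫ x : ℝ, x ^ n ∂(gaussianReal 0 1)) / n.factorial) / (n + 2) := by
      rw [hf]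
      field_simp
    rw [this, ih]
    by_cases h : 2 ∣ n
    · obtain ⟨j, rfl⟩ := h
      rw [show 2 * j + 2 = 2 * (j + 1) by ring, coeff_gaussSeries_two_mul,
        coeff_gaussSeries_two_mul]
      push_cast [Nat.factorial_succ]
      field_simp
      ring
    · rw [coeff_gaussSeries_of_not_dvd _ h, coeff_gaussSeries_of_not_dvd _ (by omega)]
      simp

theorem hermiteOne_eq_sum_coeff (n : ℕ) (x t : ℝ) :
    hermiteOne n x t = n.factorial * ∑ q ∈ Finset.HasAntidiagonal.antidiagonal n,
      PowerSeries.coeff q.1 (gaussSeries t) * (x ^ q.2 / q.2.factorial) := by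
  rw [hermiteOne_eq_coeff, PowerSeries.coeff_mul]
  simp_rw [coeff_expSeries]

/-- Taking the mean replaces `exp (x z)` by `exp (z² / 2)`, which cancels the factor `exp (-z² /
2)`. This is the martingale property for one unit of time started at the origin; the addition
formula makes other starting points unnecessary. -/
theorem integral_hermiteOne (n : ℕ) :
    ∫ x, hermiteOne n x 1 ∂(gaussianReal 0 1) = hermiteOne n 0 0 := by
  simp_rw [hermiteOne_eq_sum_coeff n _ 1]
  rw [integral_const_mul, integral_finsetSum _
    (fun q _ => ((integrable_pow_gaussianReal q.2).div_const _).const_mul _)]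
  simp_rw [integral_const_mul, integral_div, integral_pow_gaussianReal]
  rw [hermiteOne_eq_coeff, gaussSeries_zero, ← PowerSeries.coeff_mul, ← gaussSeries_add,
    add_neg_cancel, gaussSeries_zero, one_mul]
  rw [coeff_expSeries, PowerSeries.coeff_one]
  rcases n with _ | n <;> simp

theorem memLp_hermiteOne (n p : ℕ) :
    MemLp (fun x => hermiteOne n x 1) p (gaussianReal 0 1) := by
  have h : ∀ k : ℕ, MemLp (fun x : ℝ => x ^ k) p (gaussianReal 0 1) := by
    intro k
    rcases Nat.eq_zero_or_pos p with rfl | hp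
    · simp only [Nat.cast_zero, memLp_zero_iff_aestronglyMeasurable]
      fun_prop
    · rw [← integrable_norm_rpow_iff (by fun_prop) (by simpa using hp.ne') (by simp)]
      have := (integrable_pow_gaussianReal (k * p)).norm
      simpa [pow_mul] using this
  unfold hermiteOne
  exact memLp_finsetSum _ fun j _ => (h _).const_mul _

/-- The standard Gaussian measure on `ℝ^d`. -/
noncomputable def stdGaussian (d : ℕ) : Measure (Fin d → ℝ) :=
  Measure.pi fun _ => gaussianReal 0 1

instance (d : ℕ) : IsProbabilityMeasure (stdGaussian d) := by
  unfold stdGaussian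
  infer_instance

theorem integral_hermite {d : ℕ} (α : Fin d → ℕ) :
    ∫ x, hermite α x 1 ∂(stdGaussian d) = hermite α 0 0 := by
  unfold hermite stdGaussian
  rw [integral_fintype_prod_eq_prod (fun i x => hermiteOne (α i) x 1)]
  simp_rw [integral_hermiteOne]
  rfl

theorem memLp_hermite {d : ℕ} (α : Fin d → ℕ) (p : ℕ) :
    MemLp (fun x => hermite α x 1) p (stdGaussian d) := by
  rcases Nat.eq_zero_or_pos p with rfl | hp
  · simpa using (measurable_hermite α 1).aestronglyMeasurable
  · rw [← integrable_norm_rpow_iff (measurable_hermite α 1).aestronglyMeasurable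
      (by simpa using hp.ne') (by simp)]
    have := Integrable.fintype_prod (μ := fun _ : Fin d => gaussianReal 0 1)
      (f := fun i (x : ℝ) => ‖hermiteOne (α i) x 1‖ ^ ((p : ℝ≥0∞)).toReal)
      (fun i => (memLp_hermiteOne (α i) p).integrable_norm_rpow (by simpa using hp.ne') (by simp))
    refine this.congr (ae_of_all _ fun x => ?_)
    simp [hermite, Finset.prod_pow]

/-! ### Moment bounds for sums with a fixed and with a random number of terms. -/

section Moments

variable {Ω : Type*} [MeasurableSpace Ω] {P : Measure Ω}

theorem eLpNorm_natCast_pow {p : ℕ} (hp : p ≠ 0) (f : Ω → ℝ) :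
    eLpNorm f p P ^ p = ∫⁻ ω, ‖f ω‖ₑ ^ p ∂P := by
  have h := eLpNorm_nnreal_pow_eq_lintegral (f := f) (μ := P) (p := (p : ℝ≥0)) (by simpa using hp)
  simpa using h

theorem integrable_abs_pow_of_memLp [IsFiniteMeasure P] {p j : ℕ} (hj : j ≤ p) {f : Ω → ℝ}
    (hf : MemLp f p P) : Integrable (fun ω => |f ω| ^ j) P := by
  rcases Nat.eq_zero_or_pos j with rfl | hj0
  · simp
  · have := (hf.mono_exponent (q := p) (p := j) (by exact_mod_cast hj)).integrable_norm_rpow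
      (by simpa using hj0.ne') (by simp)
    simpa using this

theorem integrable_pow_of_memLp [IsFiniteMeasure P] {p j : ℕ} (hj : j ≤ p) {f : Ω → ℝ}
    (hf : MemLp f p P) : Integrable (fun ω => f ω ^ j) P := by
  refine (integrable_abs_pow_of_memLp hj hf).mono' (hf.1.pow j) (ae_of_all _ fun ω => ?_)
  simp

theorem lintegral_enorm_pow_eq [IsFiniteMeasure P] {p j : ℕ} (hj : j ≤ p) {f : Ω → ℝ}
    (hf : MemLp f p P) :
    ∫⁻ ω, ‖f ω‖ₑ ^ j ∂P = ENNReal.ofReal (∫ ω, |f ω| ^ j ∂P) := by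
  rw [ofReal_integral_eq_lintegral_ofReal (integrable_abs_pow_of_memLp hj hf)
    (ae_of_all _ fun ω => by positivity)]
  refine lintegral_congr fun ω => ?_
  rw [ENNReal.ofReal_pow (abs_nonneg _), ← Real.enorm_eq_ofReal_abs]

theorem integral_abs_pow_le [IsProbabilityMeasure P] {p j : ℕ} (hj : j ≤ p) {f : Ω → ℝ}
    (hf : MemLp f p P) {b : ℝ} (hb : 0 ≤ b) (hfb : eLpNorm f p P ≤ ENNReal.ofReal b) :
    ∫ ω, |f ω| ^ j ∂P ≤ b ^ j := by
  rcases Nat.eq_zero_or_pos j with rfl | hj0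
  · simp
  · have h1 : eLpNorm f j P ≤ ENNReal.ofReal b :=
      (eLpNorm_le_eLpNorm_of_exponent_le (by exact_mod_cast hj) hf.1).trans hfb
    have h2 := pow_le_pow_left' h1 j
    rw [eLpNorm_natCast_pow hj0.ne', lintegral_enorm_pow_eq hj hf, ← ENNReal.ofReal_pow hb,
      ENNReal.ofReal_le_ofReal_iff (by positivity)] at h2
    exact h2

/-- Convexity of the power function, without independence. This crude growth in `k` is good enough
for the lower moments, the only ones to which it is applied. -/
theorem integral_abs_sum_pow_le [IsProbabilityMeasure P] {j : ℕ} (hj : j ≠ 0) (f : ℕ → Ω → ℝ)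
    (hf : ∀ i, MemLp (f i) j P) {c : ℝ} (hfc : ∀ i, ∫ ω, |f i ω| ^ j ∂P ≤ c) (k : ℕ) :
    ∫ ω, |∑ i ∈ Finset.range k, f i ω| ^ j ∂P ≤ (k : ℝ) ^ j * c := by
  obtain ⟨n, rfl⟩ := Nat.exists_eq_succ_of_ne_zero hj
  have hle : ∀ ω, |∑ i ∈ Finset.range k, f i ω| ^ (n + 1) ≤
      (k : ℝ) ^ n * ∑ i ∈ Finset.range k, |f i ω| ^ (n + 1) := by
    intro ω
    have h1 := pow_sum_le_card_mul_sum_pow (s := Finset.range k) (f := fun i => |f i ω|)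
      (fun i _ => abs_nonneg _) n
    rw [Finset.card_range] at h1
    exact (pow_le_pow_left₀ (abs_nonneg _) (Finset.abs_sum_le_sum_abs _ _) _).trans h1
  have hint : Integrable (fun ω => (k : ℝ) ^ n * ∑ i ∈ Finset.range k, |f i ω| ^ (n + 1)) P :=
    (integrable_finsetSum _ fun i _ => integrable_abs_pow_of_memLp le_rfl (hf i)).const_mul _
  calc ∫ ω, |∑ i ∈ Finset.range k, f i ω| ^ (n + 1) ∂P
      ≤ ∫ ω, (k : ℝ) ^ n * ∑ i ∈ Finset.range k, |f i ω| ^ (n + 1) ∂P :=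
        integral_mono_of_nonneg (ae_of_all _ fun ω => by positivity) hint (ae_of_all _ hle)
    _ = (k : ℝ) ^ n * ∑ i ∈ Finset.range k, ∫ ω, |f i ω| ^ (n + 1) ∂P := by
        rw [integral_const_mul, integral_finsetSum _
          fun i _ => integrable_abs_pow_of_memLp le_rfl (hf i)]
    _ ≤ (k : ℝ) ^ n * ∑ i ∈ Finset.range k, c := by
        gcongr with i
        exact hfc i
    _ = (k : ℝ) ^ (n + 1) * c := by
        simp
        ring

/-- A moment bound for sums of centred variables, each of which is independent of the sum of its
predecessors. The moments of order `q + 2` enter only linearly in the number of summands. -/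
theorem integral_sum_pow_le [IsProbabilityMeasure P] {q : ℕ} (f : ℕ → Ω → ℝ)
    (hf : ∀ i, MemLp (f i) (q + 2 : ℕ) P) (hmean : ∀ i, ∫ ω, f i ω ∂P = 0)
    (hind : ∀ k, IndepFun (fun ω => ∑ i ∈ Finset.range k, f i ω) (f k) P)
    {a b : ℝ} (hb : 0 ≤ b) (ha : ∀ i, ∫ ω, f i ω ^ (q + 2) ∂P ≤ a)
    (hfb : ∀ i, ∀ j ≤ q, ∫ ω, |f i ω| ^ j ∂P ≤ b ^ j) (k : ℕ) :
    ∫ ω, (∑ i ∈ Finset.range k, f i ω) ^ (q + 2) ∂P ≤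
      k * a + 2 ^ (q + 2) * (k : ℝ) ^ (q + 1) * b ^ (q + 2) := by
  have hS : ∀ k, MemLp (fun ω => ∑ i ∈ Finset.range k, f i ω) (q + 2 : ℕ) P :=
    fun k => memLp_finsetSum _ fun i _ => hf i
  have hS0 : ∀ k, ∫ ω, ∑ i ∈ Finset.range k, f i ω ∂P = 0 := by
    intro k
    rw [integral_finsetSum _ fun i _ => (hf i).integrable (by norm_cast; omega)]
    exact Finset.sum_eq_zero fun i _ => hmean i
  induction k with
  | zero => simp
  | succ k ih =>
    set S : Ω → ℝ := fun ω => ∑ i ∈ Finset.range k, f i ω with hSdef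
    -- Binomial expansion of `(S + f k) ^ (q + 2)`; independence factors each mixed moment.
    have hprod : ∀ j ≤ q + 2, Integrable (fun ω => S ω ^ j * f k ω ^ (q + 2 - j)) P ∧
        ∫ ω, S ω ^ j * f k ω ^ (q + 2 - j) ∂P =
          (∫ ω, S ω ^ j ∂P) * ∫ ω, f k ω ^ (q + 2 - j) ∂P := by
      intro j hj
      have hI : IndepFun (fun ω => S ω ^ j) (fun ω => f k ω ^ (q + 2 - j)) P :=
        (hind k).comp (φ := fun x => x ^ j) (ψ := fun x => x ^ (q + 2 - j)) (by fun_prop)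
          (by fun_prop)
      exact ⟨hI.integrable_mul (integrable_pow_of_memLp hj (hS k))
        (integrable_pow_of_memLp (Nat.sub_le _ _) (hf k)),
        hI.integral_fun_mul_eq_mul_integral ((hS k).1.pow j) ((hf k).1.pow _)⟩
    have hterm : ∀ j ∈ Finset.range (q + 2 + 1),
        (∫ ω, S ω ^ j * f k ω ^ (q + 2 - j) ∂P) * ((q + 2).choose j : ℝ) ≤
        (if j = 0 then a else 0) + (if j = q + 2 then ∫ ω, S ω ^ (q + 2) ∂P else 0) +
          ((q + 2).choose j : ℝ) * ((k : ℝ) ^ q * b ^ (q + 2)) := by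
      intro j hj
      have hj : j ≤ q + 2 := by simpa [Nat.lt_succ_iff] using hj
      rw [(hprod j hj).2]
      have hpos : 0 ≤ ((q + 2).choose j : ℝ) * ((k : ℝ) ^ q * b ^ (q + 2)) := by positivity
      by_cases h0 : j = 0
      · subst h0
        have := ha k
        simp at hpos ⊢
        linarith
      by_cases hq2 : j = q + 2
      · subst hq2
        simp at hpos ⊢
        linarith
      rw [if_neg h0, if_neg hq2]
      -- The terms `j = 1` and `j = q + 1` vanish since `S` and `f k` are centred. This is what
      -- keeps the moments of order `q + 1` out of the bound.
      by_cases h1 : j = 1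
      · subst h1
        simp only [pow_one]
        rw [hS0 k]
        simpa using hpos
      by_cases hq1 : j = q + 1
      · subst hq1
        rw [show q + 2 - (q + 1) = 1 by omega]
        simp only [pow_one]
        rw [hmean k]
        simpa using hpos
      -- Now `2 ≤ j ≤ q`, so both factors have order at most `q` and are controlled by `b`.
      have hjq : j ≤ q := by omega
      have e1 : |∫ ω, S ω ^ j ∂P| ≤ (k : ℝ) ^ j * b ^ j := by
        refine (abs_integral_le_integral_abs).trans ?_
        simp_rw [abs_pow]
        exact integral_abs_sum_pow_le h0 f
          (fun i => (hf i).mono_exponent (by exact_mod_cast hj)) (fun i => hfb i j hjq) k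
      have e2 : |∫ ω, f k ω ^ (q + 2 - j) ∂P| ≤ b ^ (q + 2 - j) := by
        refine (abs_integral_le_integral_abs).trans ?_
        simp_rw [abs_pow]
        exact hfb k _ (by omega)
      have e3 : (k : ℝ) ^ j ≤ (k : ℝ) ^ q := by
        rcases Nat.eq_zero_or_pos k with hk | hk
        · subst hk
          simp [h0]
        · exact pow_le_pow_right₀ (by exact_mod_cast hk) hjq
      have e4 : (∫ ω, S ω ^ j ∂P) * ∫ ω, f k ω ^ (q + 2 - j) ∂P ≤ (k : ℝ) ^ q * b ^ (q + 2) :=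
        calc _ ≤ |∫ ω, S ω ^ j ∂P| * |∫ ω, f k ω ^ (q + 2 - j) ∂P| := by
              rw [← abs_mul]
              exact le_abs_self _
          _ ≤ ((k : ℝ) ^ j * b ^ j) * b ^ (q + 2 - j) := by gcongr
          _ = (k : ℝ) ^ j * b ^ (q + 2) := by
              rw [mul_assoc, ← pow_add, Nat.add_sub_cancel' hj]
          _ ≤ _ := by gcongr
      rw [mul_comm]
      simp only [zero_add]
      gcongr
    calc ∫ ω, (∑ i ∈ Finset.range (k + 1), f i ω) ^ (q + 2) ∂P
        = ∫ ω, ∑ j ∈ Finset.range (q + 2 + 1),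
            S ω ^ j * f k ω ^ (q + 2 - j) * ((q + 2).choose j : ℝ) ∂P := by
          congr 1
          ext ω
          rw [Finset.sum_range_succ, add_pow]
      _ = ∑ j ∈ Finset.range (q + 2 + 1),
            (∫ ω, S ω ^ j * f k ω ^ (q + 2 - j) ∂P) * ((q + 2).choose j : ℝ) := by
          rw [integral_finsetSum]
          · simp_rw [integral_mul_const]
          · intro j hj
            exact ((hprod j (by simpa [Nat.lt_succ_iff] using hj)).1).mul_const _
      _ ≤ _ := Finset.sum_le_sum hterm
      _ = a + ∫ ω, S ω ^ (q + 2) ∂P + 2 ^ (q + 2) * ((k : ℝ) ^ q * b ^ (q + 2)) := by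
          rw [Finset.sum_add_distrib, Finset.sum_add_distrib, ← Finset.sum_mul,
            Finset.sum_ite_eq', Finset.sum_ite_eq', if_pos (by simp), if_pos (by simp)]
          congr 2
          exact_mod_cast Nat.sum_range_choose (q + 2)
      _ ≤ a + (k * a + 2 ^ (q + 2) * (k : ℝ) ^ (q + 1) * b ^ (q + 2)) +
            2 ^ (q + 2) * ((k : ℝ) ^ q * b ^ (q + 2)) := by gcongr
      _ = ((k + 1 : ℕ) : ℝ) * a +
            2 ^ (q + 2) * ((k : ℝ) ^ q * ((k + 1 : ℕ) : ℝ)) * b ^ (q + 2) := by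
          push_cast
          ring
      _ ≤ ((k + 1 : ℕ) : ℝ) * a +
            2 ^ (q + 2) * (((k + 1 : ℕ) : ℝ) ^ q * ((k + 1 : ℕ) : ℝ)) * b ^ (q + 2) := by
          gcongr
          simp
      _ = _ := by rw [← pow_succ]

theorem lintegral_randomIndex {N : Ω → ℕ} (hN : Measurable N) (F : ℕ → Ω → ℝ≥0∞)
    (hF : ∀ k, Measurable (F k)) :
    ∫⁻ ω, F (N ω) ω ∂P = ∑' k, ∫⁻ ω, Set.indicator (N ⁻¹' {k}) (F k) ω ∂P := by
  rw [← lintegral_tsum fun k =>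
    ((hF k).indicator (hN (measurableSet_singleton k))).aemeasurable]
  refine lintegral_congr fun ω => ?_
  rw [tsum_eq_single (N ω)]
  · simp
  · intro k hk
    rw [Set.indicator_of_notMem]
    simpa using hk.symm

theorem measurable_randomIndex {N : Ω → ℕ} (hN : Measurable N) {F : ℕ → Ω → ℝ}
    (hF : ∀ k, Measurable (F k)) : Measurable fun ω => F (N ω) ω :=
  (measurable_from_prod_countable_right (f := fun z : ℕ × Ω => F z.1 z.2) hF).comp
    (hN.prodMk measurable_id)

/-- The `p`-norm of a randomly stopped sequence, when the stopping index and the factor `G` are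
independent of the sequence. -/
theorem eLpNorm_mul_randomIndex_pow_le {N : Ω → ℕ} (hN : Measurable N) {G : Ω → ℝ}
    (hG : Measurable G) {S : ℕ → Ω → ℝ} (hS : ∀ k, Measurable (S k))
    (hGN : IndepFun G N P) (hind : ∀ k, IndepFun (fun ω => (G ω, N ω)) (S k) P)
    {p : ℕ} (hp : p ≠ 0) {c : ℕ → ℝ≥0∞} (hc : ∀ k, ∫⁻ ω, ‖S k ω‖ₑ ^ p ∂P ≤ c k) :
    eLpNorm (fun ω => G ω * S (N ω) ω) p P ^ p ≤
      eLpNorm G p P ^ p * ∫⁻ ω, c (N ω) ∂P := by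
  rw [eLpNorm_natCast_pow hp, eLpNorm_natCast_pow hp]
  calc ∫⁻ ω, ‖G ω * S (N ω) ω‖ₑ ^ p ∂P
      = ∑' k, ∫⁻ ω, Set.indicator (N ⁻¹' {k}) (fun ω => ‖G ω * S k ω‖ₑ ^ p) ω ∂P :=
        lintegral_randomIndex hN (fun k ω => ‖G ω * S k ω‖ₑ ^ p) fun k => by fun_prop
    _ = ∑' k, (∫⁻ ω, Set.indicator (N ⁻¹' {k}) (fun ω => ‖G ω‖ₑ ^ p) ω ∂P) *
          ∫⁻ ω, ‖S k ω‖ₑ ^ p ∂P := by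
        refine tsum_congr fun k => ?_
        have hm : Measurable fun z : ℝ × ℕ =>
            Set.indicator (Prod.snd ⁻¹' {k}) (fun z : ℝ × ℕ => ‖z.1‖ₑ ^ p) z :=
          Measurable.indicator (by fun_prop) (measurable_snd (measurableSet_singleton k))
        have h := lintegral_mul_eq_lintegral_mul_lintegral_of_indepFun
          (hm.comp (hG.prodMk hN)) (show Measurable fun ω => ‖S k ω‖ₑ ^ p by fun_prop)
          ((hind k).comp (ψ := fun x : ℝ => ‖x‖ₑ ^ p) hm (by fun_prop))
        refine Eq.trans (lintegral_congr fun ω => ?_) h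
        by_cases hω : N ω = k <;> simp [Set.indicator, hω, mul_pow]
    _ ≤ ∑' k, (∫⁻ ω, Set.indicator (N ⁻¹' {k}) (fun ω => ‖G ω‖ₑ ^ p) ω ∂P) * c k := by
        gcongr with k
        exact hc k
    _ = ∫⁻ ω, ‖G ω‖ₑ ^ p * c (N ω) ∂P := by
        rw [lintegral_randomIndex hN (fun k ω => ‖G ω‖ₑ ^ p * c k) fun k => by fun_prop]
        refine tsum_congr fun k => ?_
        rw [← lintegral_mul_const _ (Measurable.indicator (by fun_prop)
          (hN (measurableSet_singleton k)))]
        refine lintegral_congr fun ω => ?_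
        by_cases hω : N ω = k <;> simp [Set.indicator, hω]
    _ = _ := lintegral_mul_eq_lintegral_mul_lintegral_of_indepFun
        (show Measurable fun ω => ‖G ω‖ₑ ^ p by fun_prop)
        (Measurable.comp (measurable_of_countable c) hN)
        (hGN.comp (φ := fun x : ℝ => ‖x‖ₑ ^ p) (ψ := c) (by fun_prop) (measurable_of_countable c))

/-- On each event `N = k` the restriction of `G` is a function of `(G, N)`, hence independent of the
centred variable `S k`. -/
theorem integral_mul_randomIndex_eq_zero {N : Ω → ℕ} (hN : Measurable N) {G : Ω → ℝ}
    (hG : Measurable G) {S : ℕ → Ω → ℝ} (hS : ∀ k, Measurable (S k))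
    (hind : ∀ k, IndepFun (fun ω => (G ω, N ω)) (S k) P) (hS0 : ∀ k, ∫ ω, S k ω ∂P = 0)
    (hint : Integrable (fun ω => G ω * S (N ω) ω) P) :
    ∫ ω, G ω * S (N ω) ω ∂P = 0 := by
  have hU : ⋃ k, N ⁻¹' {k} = Set.univ := by
    ext ω
    simp
  rw [← setIntegral_univ, ← hU, integral_iUnion (fun k => hN (measurableSet_singleton k))
    (fun i j hij => by
      refine Set.disjoint_left.2 fun ω hi hj => hij ?_
      simp only [Set.mem_preimage, Set.mem_singleton_iff] at hi hj
      omega) hint.integrableOn]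
  refine (tsum_congr fun k => ?_).trans tsum_zero
  have hm : Measurable fun z : ℝ × ℕ =>
      Set.indicator (Prod.snd ⁻¹' {k}) (fun z : ℝ × ℕ => z.1) z :=
    Measurable.indicator (by fun_prop) (measurable_snd (measurableSet_singleton k))
  have h := ((hind k).comp (ψ := fun x : ℝ => x) hm measurable_id).integral_mul_eq_mul_integral
    (hm.comp (hG.prodMk hN)).aestronglyMeasurable (hS k).aestronglyMeasurable
  rw [← integral_indicator (hN (measurableSet_singleton k))]
  have h0 : (P[(fun x : ℝ => x) ∘ S k] : ℝ) = 0 := hS0 k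
  rw [h0, mul_zero] at h
  rw [← h]
  congr 1
  ext ω
  by_cases hω : N ω = k <;> simp [Set.indicator, hω]

/-- A norm bound for a random sum of centred variables: the top norm enters with the factor
`(E N)^(1/p)`, the lower norm with some constant. -/
theorem eLpNorm_mul_randomSum_le [IsProbabilityMeasure P] {q : ℕ} (hq : Even q)
    {N : Ω → ℕ} (hN : Measurable N) {G : Ω → ℝ} (hG : Measurable G)
    {f : ℕ → Ω → ℝ} (hfm : ∀ i, Measurable (f i))
    (hf : ∀ i, MemLp (f i) (q + 2 : ℕ) P) (hmean : ∀ i, ∫ ω, f i ω ∂P = 0)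
    (hfind : ∀ k, IndepFun (fun ω => ∑ i ∈ Finset.range k, f i ω) (f k) P)
    (hGN : IndepFun G N P)
    (hind : ∀ k, IndepFun (fun ω => (G ω, N ω)) (fun ω => ∑ i ∈ Finset.range k, f i ω) P)
    (hNp : Integrable (fun ω => (N ω : ℝ) ^ (q + 2)) P)
    {a b : ℝ} (ha : 0 ≤ a) (hb : 0 ≤ b) (hfa : ∀ i, eLpNorm (f i) (q + 2 : ℕ) P ≤ ENNReal.ofReal a)
    (hfb : ∀ i, eLpNorm (f i) q P ≤ ENNReal.ofReal b) :
    eLpNorm (fun ω => G ω * ∑ i ∈ Finset.range (N ω), f i ω) (q + 2 : ℕ) P ≤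
      eLpNorm G (q + 2 : ℕ) P * ENNReal.ofReal
        ((∫ ω, (N ω : ℝ) ∂P) ^ ((q + 2 : ℕ) : ℝ)⁻¹ * a +
          2 * (∫ ω, (N ω : ℝ) ^ (q + 2) ∂P) ^ ((q + 2 : ℕ) : ℝ)⁻¹ * b) := by
  have hp0 : q + 2 ≠ 0 := by omega
  have hpe : Even (q + 2) := hq.add even_two
  set S : ℕ → Ω → ℝ := fun k ω => ∑ i ∈ Finset.range k, f i ω with hSdef
  have hSm : ∀ k, Measurable (S k) := fun k => Finset.measurable_sum _ fun i _ => hfm i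
  have hNm : Measurable fun ω => (N ω : ℝ) := (measurable_of_countable _).comp hN
  have hN1 : Integrable (fun ω => (N ω : ℝ)) P := by
    refine hNp.mono' hNm.aestronglyMeasurable (ae_of_all _ fun ω => ?_)
    rw [Real.norm_of_nonneg (by positivity)]
    exact_mod_cast Nat.le_self_pow hp0 (N ω)
  -- The power `k ^ (q + 1)` is relaxed to `k ^ (q + 2)`, so that the `p`-th moment of `N` appears,
  -- while the coefficient of `a ^ (q + 2)` stays linear in `k`.
  have hbound : ∀ k, ∫⁻ ω, ‖S k ω‖ₑ ^ (q + 2) ∂P ≤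
      ENNReal.ofReal (k * a ^ (q + 2) + 2 ^ (q + 2) * (k : ℝ) ^ (q + 2) * b ^ (q + 2)) := by
    intro k
    rw [lintegral_enorm_pow_eq le_rfl (memLp_finsetSum _ fun i _ => hf i)]
    refine ENNReal.ofReal_le_ofReal ?_
    simp_rw [hpe.pow_abs]
    refine (integral_sum_pow_le f hf hmean hfind hb (a := a ^ (q + 2)) (fun i => ?_)
      (fun i j hj => ?_) k).trans ?_
    · simpa [hpe.pow_abs] using integral_abs_pow_le le_rfl (hf i) ha (hfa i)
    · exact integral_abs_pow_le hj ((hf i).mono_exponent (by norm_cast; omega)) hb (hfb i)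
    · gcongr 2
      rcases Nat.eq_zero_or_pos k with rfl | hk
      · simp
      · gcongr
        · exact_mod_cast hk
        · omega
  have key := eLpNorm_mul_randomIndex_pow_le hN hG hSm hGN hind hp0 hbound
  set M1 := ∫ ω, (N ω : ℝ) ∂P
  set Mp := ∫ ω, (N ω : ℝ) ^ (q + 2) ∂P
  have hM1 : 0 ≤ M1 := integral_nonneg fun ω => by positivity
  have hMp : 0 ≤ Mp := integral_nonneg fun ω => by positivity
  have hlin : ∫⁻ ω, ENNReal.ofReal ((N ω : ℝ) * a ^ (q + 2) +
      2 ^ (q + 2) * (N ω : ℝ) ^ (q + 2) * b ^ (q + 2)) ∂P =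
      ENNReal.ofReal (M1 * a ^ (q + 2) + 2 ^ (q + 2) * Mp * b ^ (q + 2)) := by
    have i1 : Integrable (fun ω => (N ω : ℝ) * a ^ (q + 2)) P := hN1.mul_const _
    have i2 : Integrable (fun ω => 2 ^ (q + 2) * (N ω : ℝ) ^ (q + 2) * b ^ (q + 2)) P :=
      (hNp.const_mul _).mul_const _
    refine (ofReal_integral_eq_lintegral_ofReal (i1.add i2) (ae_of_all _ fun ω => by
      simp only [Pi.zero_apply, Pi.add_apply]
      positivity)).symm.trans ?_
    congr 1
    simp only [Pi.add_apply]
    rw [integral_add i1 i2, integral_mul_const, integral_mul_const, integral_const_mul]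
  rw [hlin] at key
  have hpinv : ∀ x : ℝ, 0 ≤ x → (x ^ ((q + 2 : ℕ) : ℝ)⁻¹) ^ (q + 2) = x := fun x hx =>
    Real.rpow_inv_natCast_pow hx hp0
  -- Superadditivity `x ^ p + y ^ p ≤ (x + y) ^ p` allows the `p`-th root to be taken in each
  -- summand separately.
  have hreal : M1 * a ^ (q + 2) + 2 ^ (q + 2) * Mp * b ^ (q + 2) ≤
      (M1 ^ ((q + 2 : ℕ) : ℝ)⁻¹ * a + 2 * Mp ^ ((q + 2 : ℕ) : ℝ)⁻¹ * b) ^ (q + 2) := by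
    refine le_trans (le_of_eq ?_) (pow_add_pow_le (by positivity) (by positivity) hp0)
    rw [mul_pow, mul_pow, mul_pow, hpinv _ hM1, hpinv _ hMp]
  refine (ENNReal.pow_le_pow_left_iff hp0).1 (key.trans ?_)
  rw [mul_pow, ← ENNReal.ofReal_pow (by positivity)]
  gcongr

end Moments

/-! ### Change of variables and products in `L^p`. -/

section Auxiliary

variable {A B : Type*} [MeasurableSpace A] [MeasurableSpace B] {μ : Measure A} {ρ : Measure B}

theorem integral_comp_of_measurePreserving {f : A → B} (hf : MeasurePreserving f μ ρ) {g : B → ℝ}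
    (hg : AEStronglyMeasurable g ρ) : ∫ x, g (f x) ∂μ = ∫ y, g y ∂ρ := by
  have h := hf.map_eq
  rw [← integral_map hf.measurable.aemeasurable (by rwa [h]), h]

theorem memLp_mul_prod [SFinite μ] [SFinite ρ] {p : ℕ} (hp : p ≠ 0) {f : A → ℝ} {g : B → ℝ}
    (hf : MemLp f p μ) (hg : MemLp g p ρ) :
    MemLp (fun z : A × B => f z.1 * g z.2) p (μ.prod ρ) := by
  have hp0 : ((p : ℕ) : ℝ≥0∞) ≠ 0 := by simpa using hp
  rw [← integrable_norm_rpow_iff (f := fun z : A × B => f z.1 * g z.2)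
    (hf.1.comp_fst.mul hg.1.comp_snd) hp0 (by simp)]
  refine ((hf.integrable_norm_rpow hp0 (by simp)).mul_prod
    (hg.integrable_norm_rpow hp0 (by simp))).congr (ae_of_all _ fun z => ?_)
  simp [mul_pow]

end Auxiliary

/-! ### Labelled configurations, subtrees and centred increments. -/

section Configurations

/-- A configuration attaches to each label the displacement of the particle during its life and
the number of its offspring. -/
abbrev Config (d : ℕ) := List ℕ → (Fin d → ℝ) × ℕ

variable {d : ℕ}

/-- The configuration seen from the `i`-th child of the ancestor. -/
def subtree (i : ℕ) (e : Config d) : Config d := fun u => e (u ++ [i])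

/-- The law of a configuration with independent labels. -/
noncomputable def configMeasure (d : ℕ) (ν : Measure ℕ) : Measure (Config d) :=
  Measure.infinitePi fun _ : List ℕ => (stdGaussian d).prod ν

/-- The sum over generation `t` of `φ (Y u) H_α(·, t + 1)` at the place of death minus
`c H_α(·, t)` at the place of birth, organized by the children of the ancestor. -/
noncomputable def increment (φ : ℕ → ℝ) (c : ℝ) : ℕ → (Fin d → ℕ) → Config d → ℝ
  | 0, α, e => φ (e []).2 * hermite α (e []).1 1 - c * hermite α 0 0
  | t + 1, α, e => ∑ β ∈ Finset.Iic α, ((multiChoose α β : ℝ) * hermite (α - β) (e []).1 1) *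
      ∑ i ∈ Finset.range (e []).2, increment φ c t β (subtree i e)

/-- The σ-algebra generated by the labels in `S`. -/
@[reducible]
def labelSpace (d : ℕ) (S : Set (List ℕ)) : MeasurableSpace (Config d) :=
  ⨆ u ∈ S, MeasurableSpace.comap (fun e : Config d => e u) inferInstance

theorem measurable_subtree (i : ℕ) : Measurable (subtree i : Config d → Config d) :=
  measurable_pi_lambda _ fun u => measurable_pi_apply (u ++ [i])

theorem measurable_eval_labelSpace {S : Set (List ℕ)} {u : List ℕ} (hu : u ∈ S) :
    Measurable[labelSpace d S] fun e : Config d => e u :=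
  Measurable.mono (comap_measurable _)
    (le_iSup₂_of_le (f := fun u (_ : u ∈ S) => MeasurableSpace.comap (fun e : Config d => e u)
      inferInstance) u hu le_rfl) le_rfl

theorem measurable_subtree_labelSpace {S : Set (List ℕ)} {i : ℕ} (hi : ∀ u, u ++ [i] ∈ S) :
    Measurable[labelSpace d S] (subtree i : Config d → Config d) :=
  @measurable_pi_lambda _ _ _ (labelSpace d S) _ _ fun u => measurable_eval_labelSpace (hi u)

variable {ν : Measure ℕ} [IsProbabilityMeasure ν]

instance : IsProbabilityMeasure (configMeasure d ν) := by
  unfold configMeasure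
  infer_instance

/-- The relabelling `u ↦ u ++ [i]` is injective, so it selects a subfamily of the same independent,
identically distributed labels. -/
theorem measurePreserving_subtree (i : ℕ) :
    MeasurePreserving (subtree i : Config d → Config d) (configMeasure d ν) (configMeasure d ν) :=
  ⟨measurable_subtree i, Measure.map_infinitePi_infinitePi_of_inj
    (P := fun _ : List ℕ => (stdGaussian d).prod ν) (f := fun u => u ++ [i])
    (List.append_left_injective [i])⟩

theorem measurePreserving_root :
    MeasurePreserving (fun e : Config d => e []) (configMeasure d ν) ((stdGaussian d).prod ν) :=
  measurePreserving_eval_infinitePi (fun _ : List ℕ => (stdGaussian d).prod ν) []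

theorem indepFun_of_labelSpace {β γ : Type*} [MeasurableSpace β] [MeasurableSpace γ]
    {S T : Set (List ℕ)} (hST : Disjoint S T) {f : Config d → β} {g : Config d → γ}
    (hf : Measurable[labelSpace d S] f) (hg : Measurable[labelSpace d T] g) :
    IndepFun f g (configMeasure d ν) := by
  have h : iIndepFun (fun (u : List ℕ) (e : Config d) => e u) (configMeasure d ν) :=
    iIndepFun_infinitePi (X := fun _ x => x) fun _ => measurable_id
  have h2 : Indep (labelSpace d S) (labelSpace d T) (configMeasure d ν) :=
    indep_iSup_of_disjoint (fun u => (measurable_pi_apply u).comap_le) h hST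
  exact indep_of_indep_of_le_left (indep_of_indep_of_le_right h2 hg.comap_le) hf.comap_le

theorem measurePreserving_root_displacement :
    MeasurePreserving (fun e : Config d => (e []).1) (configMeasure d ν) (stdGaussian d) :=
  measurePreserving_fst.comp measurePreserving_root

theorem measurePreserving_root_offspring :
    MeasurePreserving (fun e : Config d => (e []).2) (configMeasure d ν) ν :=
  measurePreserving_snd.comp measurePreserving_root

theorem indepFun_root_displacement_offspring {g : (Fin d → ℝ) → ℝ} (hg : Measurable g) :
    IndepFun (fun e : Config d => g (e []).1) (fun e : Config d => (e []).2)
      (configMeasure d ν) := by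
  have h : IndepFun (fun e : Config d => (e []).1) (fun e : Config d => (e []).2)
      (configMeasure d ν) := by
    rw [indepFun_iff_map_prod_eq_prod_map_map
      (measurePreserving_root_displacement (ν := ν)).measurable.aemeasurable
      (measurePreserving_root_offspring (ν := ν)).measurable.aemeasurable,
      measurePreserving_root_displacement.map_eq, measurePreserving_root_offspring.map_eq]
    exact measurePreserving_root.map_eq
  exact h.comp hg measurable_id

/-- The labels of the descendants of the first `k` children. -/
def firstChildren (k : ℕ) : Set (List ℕ) := {w | ∃ u, ∃ i < k, w = u ++ [i]}

theorem measurable_sum_subtree {F : Config d → ℝ} (hF : Measurable F) (k : ℕ) :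
    Measurable[labelSpace d (firstChildren k)]
      fun e : Config d => ∑ i ∈ Finset.range k, F (subtree i e) :=
  @Finset.measurable_sum _ _ _ _ _ _ (labelSpace d (firstChildren k)) _ _ fun i hi =>
    hF.comp (measurable_subtree_labelSpace fun u => ⟨u, i, Finset.mem_range.1 hi, rfl⟩)

/-- The last letter of a nonempty label names the child of the ancestor from which it descends, so
distinct children use disjoint sets of labels. -/
theorem indepFun_sum_subtree {F : Config d → ℝ} (hF : Measurable F) (k : ℕ) :
    IndepFun (fun e : Config d => ∑ i ∈ Finset.range k, F (subtree i e))
      (fun e => F (subtree k e)) (configMeasure d ν) := by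
  refine indepFun_of_labelSpace (T := {w | ∃ u, w = u ++ [k]}) ?_ (measurable_sum_subtree hF k)
    (hF.comp (measurable_subtree_labelSpace fun u => ⟨u, rfl⟩))
  rw [Set.disjoint_left]
  rintro w ⟨u, i, hi, rfl⟩ ⟨v, hv⟩
  have := (List.append_inj' hv rfl).2
  simp at this
  omega

theorem indepFun_root_sum_subtree {F : Config d → ℝ} (hF : Measurable F)
    {g : (Fin d → ℝ) → ℝ} (hg : Measurable g) (k : ℕ) :
    IndepFun (fun e : Config d => (g (e []).1, (e []).2))
      (fun e : Config d => ∑ i ∈ Finset.range k, F (subtree i e)) (configMeasure d ν) := by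
  refine indepFun_of_labelSpace (S := {[]}) ?_ ?_ (measurable_sum_subtree hF k)
  · rw [Set.disjoint_left]
    rintro w rfl ⟨u, i, hi, h⟩
    simp at h
  · exact (show Measurable fun x : (Fin d → ℝ) × ℕ => (g x.1, x.2) by fun_prop).comp
      (measurable_eval_labelSpace rfl)

theorem measurable_randomSum {g : (Fin d → ℝ) → ℝ} (hg : Measurable g) {F : Config d → ℝ}
    (hF : Measurable F) : Measurable fun e : Config d =>
      g (e []).1 * ∑ i ∈ Finset.range (e []).2, F (subtree i e) := by
  have h := measurable_randomIndex (show Measurable fun e : Config d => (e []).2 by fun_prop)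
    (F := fun k e => ∑ i ∈ Finset.range k, F (subtree i e))
    fun k => Finset.measurable_sum _ fun i _ => hF.comp (measurable_subtree i)
  exact Measurable.mul (by fun_prop) h

theorem measurable_increment (φ : ℕ → ℝ) (c : ℝ) (t : ℕ) (α : Fin d → ℕ) :
    Measurable (increment φ c t α) := by
  induction t generalizing α with
  | zero =>
    have h1 : Measurable fun e : Config d => φ (e []).2 :=
      (measurable_of_countable φ).comp (by fun_prop)
    have h2 : Measurable fun e : Config d => hermite α (e []).1 1 :=
      (measurable_hermite α 1).comp (by fun_prop)
    exact (h1.mul h2).sub_const _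
  | succ t ih =>
    exact Finset.measurable_sum _ fun β _ =>
      measurable_randomSum ((measurable_hermite (α - β) 1).const_mul _) (ih β)

/-- The one-step estimate behind the recursion: `F` in the subtrees of the children gives centred
independent copies, and the label of the ancestor is independent of all of them. -/
theorem eLpNorm_randomSum_subtree_le {q : ℕ} (hq : Even q)
    (hν : Integrable (fun ℓ : ℕ => (ℓ : ℝ) ^ (q + 2)) ν) {g : (Fin d → ℝ) → ℝ} (hg : Measurable g)
    {F : Config d → ℝ} (hF : Measurable F) (hFp : MemLp F (q + 2 : ℕ) (configMeasure d ν))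
    (hF0 : ∫ e, F e ∂(configMeasure d ν) = 0) :
    eLpNorm (fun e : Config d => g (e []).1 * ∑ i ∈ Finset.range (e []).2, F (subtree i e))
      (q + 2 : ℕ) (configMeasure d ν) ≤
    eLpNorm g (q + 2 : ℕ) (stdGaussian d) *
      (ENNReal.ofReal (offspringMean ν ^ ((q + 2 : ℕ) : ℝ)⁻¹) *
          eLpNorm F (q + 2 : ℕ) (configMeasure d ν) +
        ENNReal.ofReal (2 * (∫ ℓ : ℕ, (ℓ : ℝ) ^ (q + 2) ∂ν) ^ ((q + 2 : ℕ) : ℝ)⁻¹) *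
          eLpNorm F q (configMeasure d ν)) := by
  have hoff := measurePreserving_root_offspring (d := d) (ν := ν)
  have hdis := measurePreserving_root_displacement (d := d) (ν := ν)
  have hFq : MemLp F q (configMeasure d ν) := hFp.mono_exponent (by norm_cast; omega)
  have hsub : ∀ (i : ℕ) (r : ℝ≥0∞), eLpNorm (fun e => F (subtree i e)) r (configMeasure d ν) =
      eLpNorm F r (configMeasure d ν) := fun i r =>
    eLpNorm_comp_measurePreserving hF.aestronglyMeasurable (measurePreserving_subtree i)
  have key := eLpNorm_mul_randomSum_le (P := configMeasure d ν) hq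
    (N := fun e => (e []).2) hoff.measurable (G := fun e => g (e []).1)
    (hg.comp hdis.measurable) (f := fun i e => F (subtree i e))
    (fun i => hF.comp (measurable_subtree i))
    (fun i => hFp.comp_measurePreserving (measurePreserving_subtree i))
    (fun i => (integral_comp_of_measurePreserving (measurePreserving_subtree i)
      hF.aestronglyMeasurable).trans hF0)
    (indepFun_sum_subtree hF) (indepFun_root_displacement_offspring hg)
    (indepFun_root_sum_subtree hF hg)
    (hoff.integrable_comp_of_integrable (g := fun ℓ : ℕ => (ℓ : ℝ) ^ (q + 2)) hν)
    (a := (eLpNorm F (q + 2 : ℕ) (configMeasure d ν)).toReal)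
    (b := (eLpNorm F q (configMeasure d ν)).toReal) ENNReal.toReal_nonneg ENNReal.toReal_nonneg
    (fun i => by rw [hsub, ENNReal.ofReal_toReal hFp.2.ne])
    (fun i => by rw [hsub, ENNReal.ofReal_toReal hFq.2.ne])
  have hg' : eLpNorm (fun e : Config d => g (e []).1) (q + 2 : ℕ) (configMeasure d ν) =
      eLpNorm g (q + 2 : ℕ) (stdGaussian d) :=
    eLpNorm_comp_measurePreserving hg.aestronglyMeasurable hdis
  have h1 : ∫ e : Config d, ((e []).2 : ℝ) ∂(configMeasure d ν) = offspringMean ν :=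
    integral_comp_of_measurePreserving hoff (g := fun ℓ : ℕ => (ℓ : ℝ)) (by fun_prop)
  have h2 : ∫ e : Config d, ((e []).2 : ℝ) ^ (q + 2) ∂(configMeasure d ν) =
      ∫ ℓ : ℕ, (ℓ : ℝ) ^ (q + 2) ∂ν :=
    integral_comp_of_measurePreserving hoff (g := fun ℓ : ℕ => (ℓ : ℝ) ^ (q + 2)) (by fun_prop)
  rw [hg', h1, h2] at key
  have hm : 0 ≤ offspringMean ν := integral_nonneg fun ℓ => by positivity
  have hM : 0 ≤ ∫ ℓ : ℕ, (ℓ : ℝ) ^ (q + 2) ∂ν := integral_nonneg fun ℓ => by positivity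
  rwa [ENNReal.ofReal_add (by positivity) (by positivity), ENNReal.ofReal_mul (by positivity),
    ENNReal.ofReal_mul (p := 2 * _) (by positivity), ENNReal.ofReal_toReal hFp.2.ne,
    ENNReal.ofReal_toReal hFq.2.ne] at key

theorem memLp_randomSum_subtree {q : ℕ} (hq : Even q)
    (hν : Integrable (fun ℓ : ℕ => (ℓ : ℝ) ^ (q + 2)) ν) {g : (Fin d → ℝ) → ℝ} (hg : Measurable g)
    (hgp : MemLp g (q + 2 : ℕ) (stdGaussian d))
    {F : Config d → ℝ} (hF : Measurable F) (hFp : MemLp F (q + 2 : ℕ) (configMeasure d ν))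
    (hF0 : ∫ e, F e ∂(configMeasure d ν) = 0) :
    MemLp (fun e : Config d => g (e []).1 * ∑ i ∈ Finset.range (e []).2, F (subtree i e))
      (q + 2 : ℕ) (configMeasure d ν) := by
  refine ⟨(measurable_randomSum hg hF).aestronglyMeasurable,
    (eLpNorm_randomSum_subtree_le hq hν hg hF hFp hF0).trans_lt ?_⟩
  have hFq : MemLp F q (configMeasure d ν) := hFp.mono_exponent (by norm_cast; omega)
  exact ENNReal.mul_lt_top hgp.2 (ENNReal.add_lt_top.2
    ⟨ENNReal.mul_lt_top ENNReal.ofReal_lt_top hFp.2,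
      ENNReal.mul_lt_top ENNReal.ofReal_lt_top hFq.2⟩)

theorem integral_randomSum_subtree {g : (Fin d → ℝ) → ℝ} (hg : Measurable g)
    {F : Config d → ℝ} (hF : Measurable F) (hFi : Integrable F (configMeasure d ν))
    (hF0 : ∫ e, F e ∂(configMeasure d ν) = 0)
    (hint : Integrable (fun e : Config d =>
      g (e []).1 * ∑ i ∈ Finset.range (e []).2, F (subtree i e)) (configMeasure d ν)) :
    ∫ e : Config d, g (e []).1 * ∑ i ∈ Finset.range (e []).2, F (subtree i e)
      ∂(configMeasure d ν) = 0 := by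
  refine integral_mul_randomIndex_eq_zero (N := fun e : Config d => (e []).2) (by fun_prop)
    (G := fun e => g (e []).1) (by fun_prop)
    (S := fun k e => ∑ i ∈ Finset.range k, F (subtree i e))
    (fun k => Finset.measurable_sum _ fun i _ => hF.comp (measurable_subtree i))
    (indepFun_root_sum_subtree hF hg) (fun k => ?_) hint
  have hp := fun i => measurePreserving_subtree (d := d) (ν := ν) i
  refine (integral_finsetSum _ fun i _ => (hp i).integrable_comp_of_integrable hFi).trans ?_
  exact Finset.sum_eq_zero fun i _ =>
    (integral_comp_of_measurePreserving (hp i) hF.aestronglyMeasurable).trans hF0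

theorem memLp_increment_zero {p : ℕ} (hp : p ≠ 0) {φ : ℕ → ℝ} (hφ : MemLp φ p ν) (c : ℝ)
    (α : Fin d → ℕ) : MemLp (increment φ c 0 α) p (configMeasure d ν) := by
  have h := (memLp_mul_prod hp (memLp_hermite α p) hφ).comp_measurePreserving
    (measurePreserving_root (d := d) (ν := ν))
  refine MemLp.sub ?_ (memLp_const _)
  simpa [Function.comp_def, mul_comm] using h

/-- The displacement and the offspring number of the ancestor are independent, so the mean factors;
choosing `c` as the mean of `φ` makes the difference centred. -/
theorem integral_increment_zero {φ : ℕ → ℝ} (hφ : Integrable φ ν) (α : Fin d → ℕ) :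
    ∫ e, increment φ (∫ ℓ, φ ℓ ∂ν) 0 α e ∂(configMeasure d ν) = 0 := by
  have hH : Integrable (fun x : Fin d → ℝ => hermite α x 1) (stdGaussian d) := by
    have := memLp_hermite α 1
    rwa [Nat.cast_one, memLp_one_iff_integrable] at this
  have hroot := measurePreserving_root (d := d) (ν := ν)
  have hi := hH.mul_prod hφ
  have h1 : ∫ e : Config d, hermite α (e []).1 1 * φ (e []).2 ∂(configMeasure d ν) =
      hermite α 0 0 * ∫ ℓ, φ ℓ ∂ν := by
    refine (integral_comp_of_measurePreserving hroot hi.aestronglyMeasurable).trans ?_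
    rw [integral_prod_mul (fun x => hermite α x 1) φ, integral_hermite]
  have h2 : Integrable (fun e : Config d => hermite α (e []).1 1 * φ (e []).2)
    (configMeasure d ν) := hroot.integrable_comp_of_integrable hi
  simp only [increment]
  simp_rw [mul_comm (φ _)]
  rw [integral_sub h2 (integrable_const _), h1]
  simp [mul_comm]

/-- The two claims go through one induction because the `L^p` bound for the random sum at step `t +
1` needs the increments at step `t` to be centred. -/
theorem memLp_increment_and_integral {q : ℕ} (hq : Even q)
    (hν : Integrable (fun ℓ : ℕ => (ℓ : ℝ) ^ (q + 2)) ν) {φ : ℕ → ℝ}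
    (hφ : MemLp φ (q + 2 : ℕ) ν) (t : ℕ) (α : Fin d → ℕ) :
    MemLp (increment φ (∫ ℓ, φ ℓ ∂ν) t α) (q + 2 : ℕ) (configMeasure d ν) ∧
      ∫ e, increment φ (∫ ℓ, φ ℓ ∂ν) t α e ∂(configMeasure d ν) = 0 := by
  have h1p : (1 : ℝ≥0∞) ≤ (q + 2 : ℕ) := by norm_cast; omega
  induction t generalizing α with
  | zero => exact ⟨memLp_increment_zero (by omega) hφ _ α, integral_increment_zero (hφ.integrable h1p) α⟩
  | succ t ih =>
    have hg : ∀ β : Fin d → ℕ, Measurable fun x => (multiChoose α β : ℝ) * hermite (α - β) x 1 :=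
      fun β => (measurable_hermite _ 1).const_mul _
    have hmem := fun β : Fin d → ℕ => memLp_randomSum_subtree hq hν (hg β)
      ((memLp_hermite (α - β) (q + 2)).const_mul _) (measurable_increment _ _ t β)
      (ih β).1 (ih β).2
    refine ⟨memLp_finsetSum _ fun β _ => hmem β, ?_⟩
    simp only [increment]
    rw [integral_finsetSum _ fun β _ => (hmem β).integrable h1p]
    exact Finset.sum_eq_zero fun β _ => integral_randomSum_subtree (hg β)
      (measurable_increment _ _ t β) ((ih β).1.integrable h1p) (ih β).2 ((hmem β).integrable h1p)

end Configurations

/-! ### Sequences growing geometrically at a rate strictly below `m`. -/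

section GeometricBounds

/-- The sequence `a` is bounded by a geometric sequence of ratio less than `m`. -/
def GeomBounded (m : ℝ) (a : ℕ → ℝ≥0∞) : Prop :=
  ∃ C r : ℝ, 0 ≤ C ∧ 0 < r ∧ r < m ∧ ∀ t, a t ≤ ENNReal.ofReal (C * r ^ t)

theorem GeomBounded.mono {m : ℝ} {a b : ℕ → ℝ≥0∞} (hb : GeomBounded m b) (h : ∀ t, a t ≤ b t) :
    GeomBounded m a := by
  obtain ⟨C, r, hC, hr, hrm, hle⟩ := hb
  exact ⟨C, r, hC, hr, hrm, fun t => (h t).trans (hle t)⟩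

theorem geomBounded_zero {m : ℝ} (hm : 0 < m) : GeomBounded m fun _ => 0 :=
  ⟨0, m / 2, le_rfl, by positivity, by linarith, fun t => by simp⟩

theorem GeomBounded.add {m : ℝ} {a b : ℕ → ℝ≥0∞} (ha : GeomBounded m a) (hb : GeomBounded m b) :
    GeomBounded m fun t => a t + b t := by
  obtain ⟨C, r, hC, hr, hrm, hle⟩ := ha
  obtain ⟨D, s, hD, hs, hsm, hle'⟩ := hb
  refine ⟨C + D, max r s, by positivity, lt_max_of_lt_left hr, max_lt hrm hsm, fun t => ?_⟩
  rw [add_mul, ENNReal.ofReal_add (by positivity) (by positivity)]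
  refine add_le_add ((hle t).trans (ENNReal.ofReal_le_ofReal ?_))
    ((hle' t).trans (ENNReal.ofReal_le_ofReal ?_))
  · gcongr
    exact le_max_left _ _
  · gcongr
    exact le_max_right _ _

theorem GeomBounded.const_mul {m : ℝ} {a : ℕ → ℝ≥0∞} (ha : GeomBounded m a) {c : ℝ≥0∞}
    (hc : c ≠ ∞) : GeomBounded m fun t => c * a t := by
  obtain ⟨C, r, hC, hr, hrm, hle⟩ := ha
  refine ⟨c.toReal * C, r, by positivity, hr, hrm, fun t => ?_⟩
  rw [mul_assoc, ENNReal.ofReal_mul ENNReal.toReal_nonneg, ENNReal.ofReal_toReal hc]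
  exact mul_le_mul_right (hle t) c

theorem GeomBounded.sum {ι : Type*} {m : ℝ} (hm : 0 < m) (s : Finset ι) {a : ι → ℕ → ℝ≥0∞}
    (ha : ∀ i ∈ s, GeomBounded m (a i)) : GeomBounded m fun t => ∑ i ∈ s, a i t := by
  classical
  induction s using Finset.induction_on with
  | empty => simpa using geomBounded_zero hm
  | insert i s hi ih =>
    simp_rw [Finset.sum_insert hi]
    exact (ha i (Finset.mem_insert_self _ _)).add
      (ih fun j hj => ha j (Finset.mem_insert_of_mem hj))

/-- Any rate strictly between `max θ r` and `m` works. Leaving room above the maximum absorbs the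
factor `t` that would occur for `θ = r`. -/
theorem GeomBounded.of_recurrence {m θ : ℝ} (hθ : 0 ≤ θ) (hθm : θ < m) {a b : ℕ → ℝ≥0∞}
    (ha0 : a 0 ≠ ∞) (hb : GeomBounded m b)
    (hrec : ∀ t, a (t + 1) ≤ ENNReal.ofReal θ * a t + b t) : GeomBounded m a := by
  obtain ⟨C, r, hC, hr, hrm, hle⟩ := hb
  obtain ⟨ρ, hρ, hρm⟩ := exists_between (max_lt hθm hrm)
  have hθρ : θ < ρ := (le_max_left _ _).trans_lt hρ
  have hrρ : r < ρ := (le_max_right _ _).trans_lt hρ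
  have hρ0 : 0 < ρ := hr.trans hrρ
  have hsub : 0 < ρ - θ := sub_pos.2 hθρ
  -- The first summand covers the initial value; the second gives `C ≤ K * (ρ - θ)`, which closes
  -- the induction step.
  set K := (a 0).toReal + C / (ρ - θ) with hK
  have hK0 : 0 ≤ K := by positivity
  have hCK : C ≤ K * (ρ - θ) := by
    rw [hK, add_mul, div_mul_cancel₀ _ hsub.ne']
    have : 0 ≤ (a 0).toReal * (ρ - θ) := by positivity
    linarith
  refine ⟨K, ρ, hK0, hρ0, hρm, fun t => ?_⟩
  induction t with
  | zero =>
    rw [pow_zero, mul_one]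
    refine ENNReal.le_ofReal_iff_toReal_le ha0 hK0 |>.2 ?_
    have : 0 ≤ C / (ρ - θ) := by positivity
    linarith
  | succ t ih =>
    calc a (t + 1) ≤ ENNReal.ofReal θ * ENNReal.ofReal (K * ρ ^ t) + ENNReal.ofReal (C * r ^ t) :=
          (hrec t).trans (by gcongr; exact hle t)
      _ = ENNReal.ofReal (θ * (K * ρ ^ t) + C * r ^ t) := by
          rw [← ENNReal.ofReal_mul hθ, ← ENNReal.ofReal_add (by positivity) (by positivity)]
      _ ≤ ENNReal.ofReal (K * ρ ^ (t + 1)) := by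
          refine ENNReal.ofReal_le_ofReal ?_
          have h1 : C * r ^ t ≤ K * (ρ - θ) * ρ ^ t := by gcongr
          calc _ ≤ θ * (K * ρ ^ t) + K * (ρ - θ) * ρ ^ t := by gcongr
            _ = _ := by ring

theorem GeomBounded.div_pow {m : ℝ} (hm : 0 < m) {a : ℕ → ℝ≥0∞} (ha : GeomBounded m a) :
    GeomBounded 1 fun t => ENNReal.ofReal ((m ^ t)⁻¹) * a t := by
  obtain ⟨C, r, hC, hr, hrm, hle⟩ := ha
  refine ⟨C, r / m, hC, by positivity, (div_lt_one hm).2 hrm, fun t => ?_⟩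
  calc _ ≤ ENNReal.ofReal ((m ^ t)⁻¹) * ENNReal.ofReal (C * r ^ t) := mul_le_mul_right (hle t) _
    _ = _ := by
      rw [← ENNReal.ofReal_mul (by positivity)]
      congr 1
      rw [_root_.div_pow]
      ring

theorem GeomBounded.succ {m : ℝ} {a : ℕ → ℝ≥0∞} (ha : GeomBounded m a) :
    GeomBounded m fun t => a (t + 1) := by
  obtain ⟨C, r, hC, hr, hrm, hle⟩ := ha
  refine ⟨C * r, r, by positivity, hr, hrm, fun t => (hle (t + 1)).trans_eq ?_⟩
  congr 1
  ring

end GeometricBounds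

/-! ### Double induction on the moment order and the multi-index. -/

section IncrementBounds

variable {d : ℕ} {ν : Measure ℕ} [IsProbabilityMeasure ν]

theorem eLpNorm_increment_succ_le {q : ℕ} (hq : Even q)
    (hν : Integrable (fun ℓ : ℕ => (ℓ : ℝ) ^ (q + 2)) ν) {φ : ℕ → ℝ}
    (hφ : MemLp φ (q + 2 : ℕ) ν) (t : ℕ) (α : Fin d → ℕ) :
    eLpNorm (increment φ (∫ ℓ, φ ℓ ∂ν) (t + 1) α) (q + 2 : ℕ) (configMeasure d ν) ≤
      ∑ β ∈ Finset.Iic α,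
        eLpNorm (fun x => (multiChoose α β : ℝ) * hermite (α - β) x 1) (q + 2 : ℕ)
          (stdGaussian d) *
        (ENNReal.ofReal (offspringMean ν ^ ((q + 2 : ℕ) : ℝ)⁻¹) *
          eLpNorm (increment φ (∫ ℓ, φ ℓ ∂ν) t β) (q + 2 : ℕ) (configMeasure d ν) +
        ENNReal.ofReal (2 * (∫ ℓ : ℕ, (ℓ : ℝ) ^ (q + 2) ∂ν) ^ ((q + 2 : ℕ) : ℝ)⁻¹) *
          eLpNorm (increment φ (∫ ℓ, φ ℓ ∂ν) t β) q (configMeasure d ν)) := by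
  have hg : ∀ β : Fin d → ℕ, Measurable fun x => (multiChoose α β : ℝ) * hermite (α - β) x 1 :=
    fun β => (measurable_hermite _ 1).const_mul _
  have h := eLpNorm_sum_le (s := Finset.Iic α) (p := (q + 2 : ℕ)) (μ := configMeasure d ν)
    (f := fun (β : Fin d → ℕ) (e : Config d) =>
      ((multiChoose α β : ℝ) * hermite (α - β) (e []).1 1) *
        ∑ i ∈ Finset.range (e []).2, increment φ (∫ ℓ, φ ℓ ∂ν) t β (subtree i e))
    (fun β _ => (measurable_randomSum (hg β) (measurable_increment _ _ t β)).aestronglyMeasurable)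
    (by norm_cast; omega)
  have he : (∑ β ∈ Finset.Iic α, fun e : Config d =>
      ((multiChoose α β : ℝ) * hermite (α - β) (e []).1 1) *
        ∑ i ∈ Finset.range (e []).2, increment φ (∫ ℓ, φ ℓ ∂ν) t β (subtree i e)) =
      increment φ (∫ ℓ, φ ℓ ∂ν) (t + 1) α := by
    ext e
    simp [increment, Finset.sum_apply]
  rw [he] at h
  refine h.trans (Finset.sum_le_sum fun β _ => ?_)
  obtain ⟨h1, h2⟩ := memLp_increment_and_integral hq hν hφ t β
  exact eLpNorm_randomSum_subtree_le hq hν (hg β) (measurable_increment _ _ t β) h1 h2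

/-- The diagonal coefficient is `H_0 = 1`. Its norm adds no factor, so the rate in the recursion for
`α` is exactly `m ^ (1/p)`. -/
theorem eLpNorm_multiChoose_self_mul_hermite (α : Fin d → ℕ) {p : ℕ} (hp : p ≠ 0) :
    eLpNorm (fun x => (multiChoose α α : ℝ) * hermite (α - α) x 1) p (stdGaussian d) = 1 := by
  have : (fun x : Fin d → ℝ => (multiChoose α α : ℝ) * hermite (α - α) x 1) = fun _ => 1 := by
    ext x
    simp [multiChoose, hermite, hermiteOne_zero_left]
  rw [this, eLpNorm_const _ (by simpa using hp) (NeZero.ne _)]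
  simp

/-- All moments of the increments grow with a rate that is smaller than the mean offspring
number. -/
theorem geomBounded_increment {p : ℕ} (hp : Even p) (hm : 1 < offspringMean ν)
    (hν : Integrable (fun ℓ : ℕ => (ℓ : ℝ) ^ p) ν) {φ : ℕ → ℝ} (hφ : MemLp φ p ν)
    (α : Fin d → ℕ) :
    GeomBounded (offspringMean ν) fun t =>
      eLpNorm (increment φ (∫ ℓ, φ ℓ ∂ν) t α) p (configMeasure d ν) := by
  have hm0 : 0 < offspringMean ν := one_pos.trans hm
  induction p using Nat.strong_induction_on generalizing α with
  | _ p ihp =>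
  -- The induction starts at `p = 0`, where `eLpNorm` is zero by convention. For `p = 2` the
  -- lower-norm term therefore disappears.
  rcases Nat.eq_zero_or_pos p with rfl | hp0
  · simpa using geomBounded_zero hm0
  obtain ⟨q, rfl⟩ : ∃ q, p = q + 2 := by
    obtain ⟨k, rfl⟩ := hp
    exact ⟨2 * k - 2, by omega⟩
  have hq : Even q := by
    obtain ⟨k, hk⟩ := hp
    exact ⟨k - 1, by omega⟩
  have hνq : Integrable (fun ℓ : ℕ => (ℓ : ℝ) ^ q) ν := by
    refine (hν.add (integrable_const 1)).mono' (by fun_prop) (ae_of_all _ fun ℓ => ?_)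
    rw [Real.norm_of_nonneg (by positivity)]
    rcases Nat.eq_zero_or_pos ℓ with rfl | hℓ
    · rcases Nat.eq_zero_or_pos q with rfl | hq0
      · simp
      · simp [hq0.ne']
    · have : (ℓ : ℝ) ^ q ≤ (ℓ : ℝ) ^ (q + 2) :=
        pow_le_pow_right₀ (by exact_mod_cast hℓ) (by omega)
      simp only [Pi.add_apply]
      linarith
  have hφq : MemLp φ q ν := hφ.mono_exponent (by norm_cast; omega)
  have hlow := ihp q (by omega) hq hνq hφq
  induction α using WellFoundedLT.induction with
  | _ α ihα =>
  have hmem := fun t β => (memLp_increment_and_integral (d := d) hq hν hφ t β).1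
  -- The supercritical case and `p ≥ 2` enter here: the exponent `1/p` is below one and the mean is
  -- above one.
  have hθ : offspringMean ν ^ ((q + 2 : ℕ) : ℝ)⁻¹ < offspringMean ν := by
    refine Real.rpow_lt_self_of_one_lt hm (inv_lt_one_of_one_lt₀ ?_)
    norm_cast
    omega
  set θ := offspringMean ν ^ ((q + 2 : ℕ) : ℝ)⁻¹
  set κ := 2 * (∫ ℓ : ℕ, (ℓ : ℝ) ^ (q + 2) ∂ν) ^ ((q + 2 : ℕ) : ℝ)⁻¹
  -- Only `β = α` in the `p`-norm is kept as the unknown. The forcing term collects the lower norms,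
  -- known from the induction on `p`, and all `β < α`, known from the induction on `α`.
  refine GeomBounded.of_recurrence (θ := θ) (by positivity) hθ (hmem 0 α).2.ne
    (b := fun t => ENNReal.ofReal κ *
        eLpNorm (increment φ (∫ ℓ, φ ℓ ∂ν) t α) q (configMeasure d ν) +
      ∑ β ∈ Finset.Iio α,
        eLpNorm (fun x => (multiChoose α β : ℝ) * hermite (α - β) x 1) (q + 2 : ℕ)
          (stdGaussian d) *
        (ENNReal.ofReal θ *
          eLpNorm (increment φ (∫ ℓ, φ ℓ ∂ν) t β) (q + 2 : ℕ) (configMeasure d ν) +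
        ENNReal.ofReal κ *
          eLpNorm (increment φ (∫ ℓ, φ ℓ ∂ν) t β) q (configMeasure d ν))) ?_ fun t => ?_
  · refine ((hlow α).const_mul ENNReal.ofReal_ne_top).add
      (GeomBounded.sum hm0 _ fun β hβ => GeomBounded.const_mul ?_ ?_)
    · exact ((ihα β (Finset.mem_Iio.1 hβ)).const_mul ENNReal.ofReal_ne_top).add
        ((hlow β).const_mul ENNReal.ofReal_ne_top)
    · exact ((memLp_hermite (α - β) (q + 2)).const_mul _).2.ne
  · refine (eLpNorm_increment_succ_le hq hν hφ t α).trans (le_of_eq ?_)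
    rw [← Finset.Iio_insert, Finset.sum_insert (by simp),
      eLpNorm_multiChoose_self_mul_hermite α (by omega), one_mul, add_assoc]

end IncrementBounds

/-! ### From geometrically small increments to convergence in `L^p` and almost surely. -/

section Convergence

variable {Ω : Type*} [MeasurableSpace Ω] {P : Measure Ω}

/-- Geometric tails make the Cauchy bounds `B N` summable, which gives an almost sure limit; the
same bounds identify it as the `L^p` limit. -/
theorem convergesInLpAndAE_of_geomBounded {p : ℕ} (hp : p ≠ 0) {X : ℕ → Ω → ℝ}
    (hX : ∀ t, MemLp (X t) p P)
    (hinc : GeomBounded 1 fun t => eLpNorm (X (t + 1) - X t) p P) :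
    ConvergesInLpAndAE X p P := by
  obtain ⟨C, r, hC, hr, hr1, hle⟩ := hinc
  have hp1 : (1 : ℝ≥0∞) ≤ p := by
    norm_cast
    omega
  have hsub : 0 < 1 - r := by linarith
  -- Twice the tail bound, since two indices are compared through `X N`; the added `1` makes the
  -- inequality strict even when `C = 0`.
  set B : ℕ → ℝ≥0∞ := fun N => ENNReal.ofReal ((2 * C / (1 - r) + 1) * r ^ N) with hB
  have hBsum : ∑' N, B N ≠ ∞ := by
    rw [hB, ← ENNReal.ofReal_tsum_of_nonneg (fun N => by positivity)
      ((summable_geometric_of_lt_one hr.le hr1).mul_left _)]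
    exact ENNReal.ofReal_ne_top
  have hone : ∀ N k, eLpNorm (X (N + k) - X N) p P ≤ ENNReal.ofReal (C / (1 - r) * r ^ N) := by
    intro N k
    have htel : X (N + k) - X N = ∑ i ∈ Finset.range k, (X (N + i + 1) - X (N + i)) :=
      (Finset.sum_range_sub (fun i => X (N + i)) k).symm
    rw [htel]
    refine (eLpNorm_sum_le (fun i _ => ((hX _).sub (hX _)).1) hp1).trans ?_
    calc _ ≤ ∑ i ∈ Finset.range k, ENNReal.ofReal (C * r ^ (N + i)) :=
          Finset.sum_le_sum fun i _ => hle _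
      _ = ENNReal.ofReal (∑ i ∈ Finset.range k, C * r ^ (N + i)) :=
          (ENNReal.ofReal_sum_of_nonneg fun i _ => by positivity).symm
      _ ≤ _ := by
          refine ENNReal.ofReal_le_ofReal ?_
          have h1 : ∑ i ∈ Finset.range k, r ^ i ≤ (1 - r)⁻¹ := by
            rw [← tsum_geometric_of_lt_one hr.le hr1]
            exact (summable_geometric_of_lt_one hr.le hr1).sum_le_tsum _
              fun i _ => by positivity
          calc ∑ i ∈ Finset.range k, C * r ^ (N + i)
              = C * r ^ N * ∑ i ∈ Finset.range k, r ^ i := by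
                rw [Finset.mul_sum]
                exact Finset.sum_congr rfl fun i _ => by ring
            _ ≤ C * r ^ N * (1 - r)⁻¹ := by gcongr
            _ = _ := by ring
  have hcau : ∀ N n k : ℕ, N ≤ n → N ≤ k → eLpNorm (X n - X k) p P < B N := by
    intro N n k hn hk
    obtain ⟨i, rfl⟩ := Nat.exists_eq_add_of_le hn
    obtain ⟨j, rfl⟩ := Nat.exists_eq_add_of_le hk
    have hsplit : X (N + i) - X (N + j) = (X (N + i) - X N) - (X (N + j) - X N) := by abel
    rw [hsplit]
    refine (eLpNorm_sub_le ((hX _).sub (hX _)).1 ((hX _).sub (hX _)).1 hp1).trans_lt ?_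
    refine (add_le_add (hone N i) (hone N j)).trans_lt ?_
    rw [← ENNReal.ofReal_add (by positivity) (by positivity), hB,
      ENNReal.ofReal_lt_ofReal_iff (by positivity)]
    have : 0 < r ^ N := by positivity
    calc _ = 2 * C / (1 - r) * r ^ N := by ring
      _ < _ := by linarith
  obtain ⟨L, hLm, hL⟩ := exists_stronglyMeasurable_limit_of_tendsto_ae (fun n => (hX n).1)
    (Lp.ae_tendsto_of_cauchy_eLpNorm (fun n => (hX n).1) hp1 hBsum hcau)
  have hlim := Lp.cauchy_tendsto_of_tendsto (fun n => (hX n).1) L hBsum hcau hL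
  exact ⟨hX, L, Lp.memLp_of_cauchy_tendsto hp1 hX L hLm.aestronglyMeasurable hlim, hlim, hL⟩

theorem ConvergesInLpAndAE.of_succ {p : ℝ≥0∞} {X : ℕ → Ω → ℝ} (h0 : MemLp (X 0) p P)
    (h : ConvergesInLpAndAE (fun t => X (t + 1)) p P) : ConvergesInLpAndAE X p P := by
  obtain ⟨hX, N, hN, h1, h2⟩ := h
  refine ⟨fun t => ?_, N, hN, (tendsto_add_atTop_iff_nat 1).1 h1, ?_⟩
  · rcases t with _ | t
    · exact h0
    · exact hX t
  · filter_upwards [h2] with ω hω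
    exact (tendsto_add_atTop_iff_nat (f := fun t => X t ω) 1).1 hω

end Convergence

/-! ### Decomposition of the tree at the ancestor. -/

section Tree

variable {Ω : Type*} {d : ℕ}

theorem sum_generation_succ (Y : List ℕ → Ω → ℕ) (n : ℕ) (ω : Ω) (g : List ℕ → ℝ) :
    ∑ u ∈ generation Y (n + 1) ω, g u =
      ∑ u ∈ generation Y n ω, ∑ i ∈ Finset.range (Y u ω), g (i :: u) := by
  rw [generation, Finset.sum_biUnion]
  · refine Finset.sum_congr rfl fun u _ => Finset.sum_image fun i _ j _ h => ?_
    exact (List.cons.inj h).1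
  · intro u _ v _ huv
    refine Finset.disjoint_left.2 fun w hu hv => huv ?_
    simp only [Finset.mem_image] at hu hv
    obtain ⟨i, _, rfl⟩ := hu
    obtain ⟨j, _, h⟩ := hv
    exact (List.cons.inj h).2.symm

/-- The definition of `generation` branches at the youngest particles, while the recursion for the
increments needs the first branching. The induction passes from one to the other. -/
theorem sum_generation_succ_root (Y : List ℕ → Ω → ℕ) (n : ℕ) (ω : Ω) (g : List ℕ → ℝ) :
    ∑ u ∈ generation Y (n + 1) ω, g u = ∑ j ∈ Finset.range (Y [] ω),
      ∑ v ∈ generation (fun u => Y (u ++ [j])) n ω, g (v ++ [j]) := by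
  induction n generalizing g with
  | zero =>
    rw [sum_generation_succ]
    simp [generation]
  | succ n ih =>
    rw [sum_generation_succ, ih]
    refine Finset.sum_congr rfl fun j _ => ?_
    rw [sum_generation_succ]
    rfl

theorem birthPlace_append (W : List ℕ → Fin d → ℝ≥0 → Ω → ℝ) (v : List ℕ) (j : ℕ) (ω : Ω) :
    birthPlace W (v ++ [j]) ω =
      (fun i => W [] i 1 ω) + birthPlace (fun u => W (u ++ [j])) v ω := by
  induction v with
  | nil =>
    ext i
    simp [birthPlace]
  | cons k v ih =>
    ext i
    simp [birthPlace, ih, add_assoc]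

theorem place_append (W : List ℕ → Fin d → ℝ≥0 → Ω → ℝ) (v : List ℕ) (j : ℕ) (s : ℝ≥0) (ω : Ω) :
    place W (v ++ [j]) s ω = (fun i => W [] i 1 ω) + place (fun u => W (u ++ [j])) v s ω := by
  ext i
  simp [place, birthPlace_append, add_assoc]

/-- The displacements at age `1` and the offspring numbers. -/
def config (W : List ℕ → Fin d → ℝ≥0 → Ω → ℝ) (Y : List ℕ → Ω → ℕ) (ω : Ω) : Config d :=
  fun u => (fun i => W u i 1 ω, Y u ω)

/-- The birth place and the place of death of a descendant contain the same ancestral displacement.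
The addition formula thus splits both Hermite terms with identical factors `H_(α-β)(·, 1)`, and
their difference factors as well. -/
theorem sum_generation_eq_increment (W : List ℕ → Fin d → ℝ≥0 → Ω → ℝ) (Y : List ℕ → Ω → ℕ)
    (φ : ℕ → ℝ) (c : ℝ) (t : ℕ) (α : Fin d → ℕ) (ω : Ω) :
    ∑ u ∈ generation Y t ω, (φ (Y u ω) * hermite α (place W u 1 ω) ((t + 1 : ℕ) : ℝ) -
      c * hermite α (birthPlace W u ω) t) = increment φ c t α (config W Y ω) := by
  induction t generalizing W Y α with
  | zero =>
    have h : place W [] 1 ω = fun i => W [] i 1 ω := by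
      ext i
      simp [place, birthPlace]
    simp [generation, increment, config, h, birthPlace]
  | succ t ih =>
    have hterm : ∀ j, ∀ v : List ℕ,
        φ (Y (v ++ [j]) ω) * hermite α (place W (v ++ [j]) 1 ω) ((t + 1 + 1 : ℕ) : ℝ) -
          c * hermite α (birthPlace W (v ++ [j]) ω) ((t + 1 : ℕ) : ℝ) =
        ∑ β ∈ Finset.Iic α,
          ((multiChoose α β : ℝ) * hermite (α - β) (fun i => W [] i 1 ω) 1) *
          (φ (Y (v ++ [j]) ω) *
            hermite β (place (fun u => W (u ++ [j])) v 1 ω) ((t + 1 : ℕ) : ℝ) -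
          c * hermite β (birthPlace (fun u => W (u ++ [j])) v ω) t) := by
      intro j v
      rw [place_append, birthPlace_append,
        show ((t + 1 + 1 : ℕ) : ℝ) = 1 + ((t + 1 : ℕ) : ℝ) by push_cast; ring, hermite_add,
        show ((t + 1 : ℕ) : ℝ) = 1 + (t : ℝ) by push_cast; ring, hermite_add,
        Finset.mul_sum, Finset.mul_sum, ← Finset.sum_sub_distrib]
      refine Finset.sum_congr rfl fun β _ => ?_
      ring
    rw [sum_generation_succ_root]
    simp_rw [hterm]
    simp only [increment]
    rw [Finset.sum_congr rfl fun j _ => Finset.sum_comm, Finset.sum_comm]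
    refine Finset.sum_congr rfl fun β _ => ?_
    rw [Finset.mul_sum]
    refine Finset.sum_congr rfl fun j _ => ?_
    rw [← Finset.mul_sum, ih (fun u => W (u ++ [j])) (fun u => Y (u ++ [j]))]
    rfl

/-- The identity is pathwise and valid for every `c`; taking the mean offspring number for `c`
centres the remainder. -/
theorem hermiteSumAfter_succ (W : List ℕ → Fin d → ℝ≥0 → Ω → ℝ) (Y : List ℕ → Ω → ℕ)
    (α : Fin d → ℕ) (c : ℝ) (t : ℕ) (ω : Ω) :
    hermiteSumAfter W Y α (t + 1) ω = c * hermiteSumAfter W Y α t ω +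
      increment (fun ℓ => (ℓ : ℝ)) c t α (config W Y ω) := by
  rw [← sum_generation_eq_increment, Finset.sum_sub_distrib, ← Finset.mul_sum]
  unfold hermiteSumAfter
  rw [sum_generation_succ, add_sub_cancel]
  refine Finset.sum_congr rfl fun u _ => ?_
  refine (Finset.sum_const (hermite α (place W u 1 ω) ((t + 1 : ℕ) : ℝ))).trans ?_
  simp

theorem hermiteSumBefore_succ (W : List ℕ → Fin d → ℝ≥0 → Ω → ℝ) (Y : List ℕ → Ω → ℕ)
    (α : Fin d → ℕ) (t : ℕ) (ω : Ω) :
    hermiteSumBefore W Y α (t + 1) ω = hermiteSumAfter W Y α t ω +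
      increment (fun _ => 1) 1 t α (config W Y ω) := by
  rw [← sum_generation_eq_increment, Finset.sum_sub_distrib, ← Finset.mul_sum]
  simp [hermiteSumAfter, hermiteSumBefore]

end Tree

/-! ### The law of the configuration induced by the process. -/

section Law

variable {Ω : Type*} [MeasurableSpace Ω] {P : Measure Ω}

/-- Two mutually independent families of independent variables form independent pairs. -/
theorem iIndepFun_prodMk {ι A B : Type*} [MeasurableSpace A] [MeasurableSpace B]
    {X : ι → Ω → A} {Z : ι → Ω → B} (hXm : ∀ i, Measurable (X i)) (hZm : ∀ i, Measurable (Z i))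
    (hX : iIndepFun X P) (hZ : iIndepFun Z P)
    (hXZ : IndepFun (fun ω i => X i ω) (fun ω i => Z i ω) P) :
    iIndepFun (fun i ω => (X i ω, Z i ω)) P := by
  have hpair : ∀ (s : Finset ι) (a : ι → Set A) (b : ι → Set B),
      (∀ i ∈ s, MeasurableSet (a i)) → (∀ i ∈ s, MeasurableSet (b i)) →
      P (⋂ i ∈ s, (X i ⁻¹' a i ∩ Z i ⁻¹' b i)) =
        P (⋂ i ∈ s, X i ⁻¹' a i) * P (⋂ i ∈ s, Z i ⁻¹' b i) := by
    intro s a b ha hb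
    have h := hXZ.measure_inter_preimage_eq_mul ((s : Set ι).pi a) ((s : Set ι).pi b)
      (MeasurableSet.pi s.countable_toSet ha) (MeasurableSet.pi s.countable_toSet hb)
    have e1 : (fun ω i => X i ω) ⁻¹' ((s : Set ι).pi a) = ⋂ i ∈ s, X i ⁻¹' a i := by
      ext ω
      simp
    have e2 : (fun ω i => Z i ω) ⁻¹' ((s : Set ι).pi b) = ⋂ i ∈ s, Z i ⁻¹' b i := by
      ext ω
      simp
    rw [e1, e2] at h
    rw [← h]
    congr 1
    ext ω
    simp [forall_and]
  -- Independence is checked on the generating π-system of measurable rectangles.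
  refine iIndepSets.iIndep (fun i => ((hXm i).prodMk (hZm i)).comap_le)
    (fun i => Set.preimage (fun ω => (X i ω, Z i ω)) ''
      (Set.image2 (· ×ˢ ·) {s : Set A | MeasurableSet s} {t : Set B | MeasurableSet t}))
    (fun i => isPiSystem_prod.comap _)
    (fun i => by rw [← MeasurableSpace.comap_generateFrom, generateFrom_prod]) ?_
  rw [iIndepSets_iff]
  intro s f hf
  have hf' : ∀ i ∈ s, ∃ a : Set A, ∃ b : Set B, MeasurableSet a ∧ MeasurableSet b ∧
      f i = X i ⁻¹' a ∩ Z i ⁻¹' b := by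
    intro i hi
    obtain ⟨r, ⟨a, ha, b, hb, rfl⟩, hr⟩ := hf i hi
    exact ⟨a, b, ha, hb, hr.symm⟩
  choose! a b ha hb hab using hf'
  rw [Set.iInter₂_congr hab, hpair s a b ha hb, hX.measure_inter_preimage_eq_mul s ha,
    hZ.measure_inter_preimage_eq_mul s hb, ← Finset.prod_mul_distrib]
  refine Finset.prod_congr rfl fun i hi => ?_
  -- The one-index case of `hpair` recombines the two factors at `i`.
  have h := hpair {i} a b (by simpa using ha i hi) (by simpa using hb i hi)
  rw [hab i hi]
  simpa using h.symm

/-- At integer times only displacements at age `1` matter. These are independent standard Gaussians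
over pairs of label and coordinate; currying groups them into one Gaussian vector per label, and the
offspring numbers are then paired in. -/
theorem IsBranchingWienerProcess.measurePreserving_config [IsProbabilityMeasure P] {d : ℕ}
    {ν : Measure ℕ} [IsProbabilityMeasure ν] {W : List ℕ → Fin d → ℝ≥0 → Ω → ℝ}
    {Y : List ℕ → Ω → ℕ} (h : IsBranchingWienerProcess W Y ν P) :
    MeasurePreserving (config W Y) P (configMeasure d ν) := by
  have hWm : ∀ u, Measurable fun ω (i : Fin d) => W u i 1 ω := fun u =>
    measurable_pi_lambda _ fun i => h.measurable_displacement u i 1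
  have hlaw1 : HasLaw (fun ω (q : List ℕ × Fin d) => W q.1 q.2 1 ω)
      (Measure.infinitePi fun _ => gaussianReal 0 1) P := by
    refine iIndepFun.hasLaw_infinitePi (X := fun (q : List ℕ × Fin d) ω => W q.1 q.2 1 ω)
      (fun q => (h.wiener q.1 q.2).hasLaw_eval 1) ?_
      (measurable_pi_lambda _ fun q => h.measurable_displacement _ _ _).aemeasurable
    exact h.indep_displacement.comp (fun _ f => f 1) fun _ => measurable_pi_apply 1
  have hcurry : MeasurePreserving (MeasurableEquiv.curry (List ℕ) (Fin d) ℝ)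
      (Measure.infinitePi fun _ => gaussianReal 0 1)
      (Measure.infinitePi fun _ : List ℕ => stdGaussian d) := by
    refine ⟨MeasurableEquiv.measurable _, ?_⟩
    rw [Measure.infinitePi_map_curry (fun (_ : List ℕ) (_ : Fin d) => gaussianReal 0 1)]
    simp_rw [Measure.infinitePi_eq_pi]
    rfl
  have hlaw2 : HasLaw (fun ω u (i : Fin d) => W u i 1 ω)
      (Measure.infinitePi fun _ : List ℕ => stdGaussian d) P :=
    hcurry.hasLaw.comp hlaw1
  have hlawW : ∀ u, HasLaw (fun ω (i : Fin d) => W u i 1 ω) (stdGaussian d) P := fun u =>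
    (measurePreserving_eval_infinitePi (fun _ : List ℕ => stdGaussian d) u).hasLaw.comp hlaw2
  have hindW : iIndepFun (fun u ω (i : Fin d) => W u i 1 ω) P :=
    (iIndepFun_iff_hasLaw_Pi_infinitePi hlawW
      (measurable_pi_lambda _ hWm).aemeasurable).2 hlaw2
  have hindWY : IndepFun (fun ω u (i : Fin d) => W u i 1 ω) (fun ω u => Y u ω) P :=
    h.indep_displacement_offspring.comp
      (φ := fun (f : List ℕ × Fin d → ℝ≥0 → ℝ) u i => f (u, i) 1) (ψ := id)
      (by fun_prop) measurable_id
  have hind := iIndepFun_prodMk hWm h.measurable_offspring hindW h.indep_offspring hindWY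
  have hm : ∀ u, Measurable fun ω => ((fun i : Fin d => W u i 1 ω), Y u ω) := fun u =>
    (hWm u).prodMk (h.measurable_offspring u)
  have hlaw : ∀ u, HasLaw (fun ω => ((fun i : Fin d => W u i 1 ω), Y u ω))
      ((stdGaussian d).prod ν) P := fun u =>
    IndepFun.hasLaw_prod (hlawW u) (h.offspring_law u)
      (hindWY.comp (measurable_pi_apply u) (measurable_pi_apply u))
  exact (hind.hasLaw_infinitePi hlaw (measurable_pi_lambda _ hm).aemeasurable).measurePreserving
    (measurable_pi_lambda _ hm)

end Law

end BranchingWiener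

/-! ### Transfer to the process and conclusion. -/

theorem proposition3p2 {Ω : Type*} [MeasurableSpace Ω] (P : Measure Ω) [IsProbabilityMeasure P]
    (d : ℕ) (ν : Measure ℕ) [IsProbabilityMeasure ν]
    (W : List ℕ → Fin d → ℝ≥0 → Ω → ℝ) (Y : List ℕ → Ω → ℕ)
    (hWY : BranchingWiener.IsBranchingWienerProcess W Y ν P)
    (hmean : 1 < BranchingWiener.offspringMean ν)
    (hvar : 0 < variance (fun ℓ : ℕ => (ℓ : ℝ)) ν)
    (p : ℕ) (hp : Even p) (hp0 : 0 < p)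
    (hmoment : Integrable (fun ℓ : ℕ => (ℓ : ℝ) ^ p) ν)
    (α : Fin d → ℕ) :
    BranchingWiener.ConvergesInLpAndAE
      (fun t ω => BranchingWiener.hermiteSumAfter W Y α t ω /
        BranchingWiener.offspringMean ν ^ t) (p : ℝ≥0∞) P ∧
    BranchingWiener.ConvergesInLpAndAE
      (fun t ω => BranchingWiener.hermiteSumBefore W Y α t ω /
        BranchingWiener.offspringMean ν ^ t) (p : ℝ≥0∞) P := by
  open BranchingWiener in
  set m := offspringMean ν
  have hm0 : 0 < m := one_pos.trans hmean
  have hmp := hWY.measurePreserving_config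
  have hp1 : (1 : ℝ≥0∞) ≤ p := by
    norm_cast
  obtain ⟨q, rfl⟩ : ∃ q, p = q + 2 := by
    obtain ⟨k, rfl⟩ := hp
    exact ⟨2 * k - 2, by omega⟩
  have hq : Even q := by
    obtain ⟨k, hk⟩ := hp
    exact ⟨k - 1, by omega⟩
  have hid : MemLp (fun ℓ : ℕ => (ℓ : ℝ)) (q + 2 : ℕ) ν := by
    rw [← integrable_norm_rpow_iff (by fun_prop) (by norm_cast) (by simp)]
    refine hmoment.congr (ae_of_all _ fun ℓ => ?_)
    simp only [ENNReal.toReal_natCast, Real.rpow_natCast, Real.norm_natCast]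
  have hone : MemLp (fun _ : ℕ => (1 : ℝ)) (q + 2 : ℕ) ν := memLp_const 1
  have hint1 : ∫ _ : ℕ, (1 : ℝ) ∂ν = 1 := by simp
  set D : ℕ → Ω → ℝ := fun t ω => increment (fun ℓ => (ℓ : ℝ)) m t α (config W Y ω)
  set R : ℕ → Ω → ℝ := fun t ω => increment (fun _ => 1) 1 t α (config W Y ω)
  have hDmem : ∀ t, MemLp (D t) (q + 2 : ℕ) P := fun t =>
    (memLp_increment_and_integral hq hmoment hid t α).1.comp_measurePreserving hmp
  have hRmem : ∀ t, MemLp (R t) (q + 2 : ℕ) P := fun t => by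
    have := (memLp_increment_and_integral hq hmoment hone t α).1.comp_measurePreserving hmp
    rwa [hint1] at this
  have hDgeo : GeomBounded m fun t => eLpNorm (D t) (q + 2 : ℕ) P := by
    refine (geomBounded_increment hp hmean hmoment hid α).mono fun t => le_of_eq ?_
    exact eLpNorm_comp_measurePreserving (measurable_increment _ _ t α).aestronglyMeasurable hmp
  have hRgeo : GeomBounded m fun t => eLpNorm (R t) (q + 2 : ℕ) P := by
    refine (geomBounded_increment hp hmean hmoment hone α).mono fun t => le_of_eq ?_
    rw [hint1]
    exact eLpNorm_comp_measurePreserving (measurable_increment _ _ t α).aestronglyMeasurable hmp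
  have hAsucc : ∀ t ω, hermiteSumAfter W Y α (t + 1) ω =
      m * hermiteSumAfter W Y α t ω + D t ω := hermiteSumAfter_succ W Y α m
  have hBsucc : ∀ t ω, hermiteSumBefore W Y α (t + 1) ω =
      hermiteSumAfter W Y α t ω + R t ω := hermiteSumBefore_succ W Y α
  have hAmem : ∀ t, MemLp (hermiteSumAfter W Y α t) (q + 2 : ℕ) P := by
    intro t
    induction t with
    | zero =>
      have : hermiteSumAfter W Y α 0 = fun _ => hermite α 0 0 := by
        ext ω
        simp [hermiteSumAfter, generation, birthPlace]
      rw [this]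
      exact memLp_const _
    | succ t ih =>
      have : hermiteSumAfter W Y α (t + 1) = fun ω => m * hermiteSumAfter W Y α t ω + D t ω :=
        funext (hAsucc t)
      rw [this]
      exact (ih.const_mul m).add (hDmem t)
  have hnorm : ∀ (t : ℕ) (f : Ω → ℝ), eLpNorm (fun ω => (m ^ t)⁻¹ * f ω) (q + 2 : ℕ) P =
      ENNReal.ofReal ((m ^ t)⁻¹) * eLpNorm f (q + 2 : ℕ) P := by
    intro t f
    have := eLpNorm_const_smul ((m ^ t)⁻¹) f (q + 2 : ℕ) P
    rw [Real.enorm_of_nonneg (by positivity)] at this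
    exact this
  have hDscaled : GeomBounded 1 fun t => eLpNorm (fun ω => (m ^ t)⁻¹ * D t ω) (q + 2 : ℕ) P := by
    simp_rw [hnorm]
    exact hDgeo.div_pow hm0
  have hRscaled : GeomBounded 1 fun t => eLpNorm (fun ω => (m ^ t)⁻¹ * R t ω) (q + 2 : ℕ) P := by
    simp_rw [hnorm]
    exact hRgeo.div_pow hm0
  have hscale : ∀ (f : Ω → ℝ), eLpNorm (fun ω => m⁻¹ * f ω) (q + 2 : ℕ) P ≤
      ‖m⁻¹‖ₑ * eLpNorm f (q + 2 : ℕ) P := fun f =>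
    (eLpNorm_const_smul m⁻¹ f (q + 2 : ℕ) P).le
  -- The extra factor `m⁻¹` arises because generation `t`, just before branching, is observed at
  -- time `t + 1`.
  have hBdiv : ∀ t ω, hermiteSumBefore W Y α (t + 1) ω / m ^ (t + 1) =
      m⁻¹ * (hermiteSumAfter W Y α t ω / m ^ t + (m ^ t)⁻¹ * R t ω) := by
    intro t ω
    rw [hBsucc, pow_succ]
    field_simp
  have hAdiff : ∀ t ω, hermiteSumAfter W Y α (t + 1) ω / m ^ (t + 1) -
      hermiteSumAfter W Y α t ω / m ^ t = m⁻¹ * ((m ^ t)⁻¹ * D t ω) := by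
    intro t ω
    rw [hAsucc]
    field_simp
    ring
  have hAdivmem : ∀ t, MemLp (fun ω => hermiteSumAfter W Y α t ω / m ^ t) (q + 2 : ℕ) P :=
    fun t => by simpa only [div_eq_mul_inv] using (hAmem t).mul_const (m ^ t)⁻¹
  have hRdivmem : ∀ t, MemLp (fun ω => (m ^ t)⁻¹ * R t ω) (q + 2 : ℕ) P :=
    fun t => (hRmem t).const_mul _
  have hDdivmem : ∀ t, MemLp (fun ω => (m ^ t)⁻¹ * D t ω) (q + 2 : ℕ) P :=
    fun t => (hDmem t).const_mul _
  refine ⟨convergesInLpAndAE_of_geomBounded (by omega) hAdivmem ?_,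
    ConvergesInLpAndAE.of_succ ?_ (convergesInLpAndAE_of_geomBounded (by omega) (fun t => ?_) ?_)⟩
  · refine (hDscaled.const_mul (c := ‖m⁻¹‖ₑ) (by simp)).mono fun t => ?_
    rw [show ((fun ω => hermiteSumAfter W Y α (t + 1) ω / m ^ (t + 1)) -
      fun ω => hermiteSumAfter W Y α t ω / m ^ t) = fun ω => m⁻¹ * ((m ^ t)⁻¹ * D t ω) from
      funext (hAdiff t)]
    exact hscale _
  · exact memLp_const (hermite α 0 0 / m ^ 0)
  · simp_rw [hBdiv]
    exact ((hAdivmem t).add (hRdivmem t)).const_mul _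
  · refine ((((hDscaled.const_mul (c := ‖m⁻¹‖ₑ) (by simp)).add hRscaled.succ).add
      hRscaled).const_mul (c := ‖m⁻¹‖ₑ) (by simp)).mono fun t => ?_
    -- Each increment before branching is an increment after branching plus the difference of two
    -- consecutive scaled remainders, all three geometrically small.
    have e : ((fun ω => hermiteSumBefore W Y α (t + 1 + 1) ω / m ^ (t + 1 + 1)) -
        fun ω => hermiteSumBefore W Y α (t + 1) ω / m ^ (t + 1)) = fun ω => m⁻¹ *
        ((m⁻¹ * ((m ^ t)⁻¹ * D t ω) + (m ^ (t + 1))⁻¹ * R (t + 1) ω) - (m ^ t)⁻¹ * R t ω) := by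
      ext ω
      rw [Pi.sub_apply, hBdiv, hBdiv, ← hAdiff]
      ring
    rw [e]
    refine (hscale _).trans (mul_le_mul_right ?_ _)
    refine (eLpNorm_sub_le (((hDdivmem t).const_mul _).add (hRdivmem (t + 1))).1
      (hRdivmem t).1 hp1).trans ?_
    gcongr
    refine (eLpNorm_add_le ((hDdivmem t).const_mul _).1 (hRdivmem (t + 1)).1 hp1).trans ?_
    gcongr
    exact hscale _
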